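/- \textbf{Definitions.} For $r\in\{1,2\}$ let $\mathrm{Diff}^{r}_+([0,1])$ be the group of orientation-preserving $C^r$ diffeomorphisms of $[0,1]$, and let $\mathrm{Diff}^{1+\mathrm{bv}}_+([0,1])\supset \mathrm{Diff}^2_+([0,1])$ be the group of those $f\in\mathrm{Diff}^1_+([0,1])$ whose derivative $Df$ has finite total variation. Let $\mathrm{Diff}^{2,\Delta}_+([0,1])$ be the set of those $f\in\mathrm{Diff}^2_+([0,1])$ having no fixed point in $(0,1)$. An element $g$ of a group $G$ is a \emph{distorted element} of $G$ if $g$ has infinite order and there is a finitely generated subgroup $H\le G$ containing $g$ and a finite generating set $S$ of $H$ such that $\ell_S(g^n)/n\to 0$ as $n\to\infty$, where $\ell_S$ denotes the word length in $H$ with respect to $S$. For $f\in\mathrm{Diff}^{2,\Delta}_+([0,1])$ there are a unique $C^1$ vector field $X$ on $[0,1)$ and a unique $C^1$ vector field $Y$ on $(0,1]$ such that $f$ is the time-$1$ map of the flow $(f_t)_{t\in\mathbb R}$ of $X$ on $[0,1)$ and the time-$1$ map of the flow $(f^t)_{t\in\mathbb R}$ of $Y$ on $(0,1]$. For $a,b\in(0,1)$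 set $\psi_X(t)=f_t(a)$, $\psi_Y(t)=f^t(b)$ and $M^{a,b}_f=\psi_Y^{-1}\circ\psi_X:\mathbb R\to\mathbb R$. This map commutes with the translation by $1$ and hence induces a circle diffeomorphism; its class modulo pre- and post-composition with rotations does not depend on $a,b$ and is called the \emph{Mather invariant} of $f$. It is \emph{trivial} if it is the class of the rotations (that is, if the maps $M^{a,b}_f$ are translations), and \emph{nontrivial} otherwise. \textbf{Statement.} \begin{enumerate} \item If $f\in\mathrm{Diff}^{2,\Delta}_+([0,1])$ has nontrivial Mather invariant, then $f$ is not a distorted element of $\mathrm{Diff}^{1+\mathrm{bv}}_+([0,1])$. \item More generally, if $f\in\mathrm{Diff}^{2}_+([0,1])$ is not the time-$1$ map of the flow of a $C^1$ vector field on $[0,1]$, then $f$ is not a distorted element of $\mathrm{Diff}^{1+\mathrm{bv}}_+([0,1])$. \end{enumerate} -/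

import Mathlib

open Set Filter Topology

/-- The ambient group of increasing homeomorphisms of `[0,1]`. An order automorphism of `[0,1]` is
the same thing as an orientation-preserving homeomorphism; the product is composition. -/
abbrev HomeoPlus : Type := unitInterval ≃o unitInterval

namespace HomeoPlus

/-- `f` as a function of a real variable (constant to the left of `0` and to the right of `1`;
only its values on `[0,1]` matter below). -/
noncomputable def ext (f : HomeoPlus) : ℝ → ℝ :=
  IccExtend (zero_le_one (α := ℝ)) (fun x => (f x : ℝ))

theorem ext_coe (f : HomeoPlus) (x : unitInterval) : ext f (x : ℝ) = (f x : ℝ) :=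
  IccExtend_val _ _ x

theorem ext_mapsTo (f : HomeoPlus) : MapsTo (ext f) (Icc 0 1) (Icc 0 1) := by
  intro x hx
  rw [show x = ((⟨x, hx⟩ : unitInterval) : ℝ) from rfl, ext_coe]
  exact (f ⟨x, hx⟩).2

theorem ext_one {x : ℝ} (hx : x ∈ Icc (0 : ℝ) 1) : ext 1 x = x :=
  ext_coe 1 ⟨x, hx⟩

theorem ext_mul (f g : HomeoPlus) {x : ℝ} (hx : x ∈ Icc (0 : ℝ) 1) :
    ext (f * g) x = ext f (ext g x) := by
  rw [show x = ((⟨x, hx⟩ : unitInterval) : ℝ) from rfl, ext_coe, ext_coe, ext_coe]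
  rfl

theorem ext_monotone (f : HomeoPlus) : MonotoneOn (ext f) (Icc 0 1) := by
  intro x hx y hy hxy
  rw [show x = ((⟨x, hx⟩ : unitInterval) : ℝ) from rfl,
    show y = ((⟨y, hy⟩ : unitInterval) : ℝ) from rfl, ext_coe, ext_coe]
  exact f.monotone hxy

end HomeoPlus

open HomeoPlus

/-- `Diff^r_+([0,1])`: the group of orientation-preserving `C^r` diffeomorphisms of `[0,1]`
(`f` and its inverse are of class `C^r` up to the endpoints). -/
noncomputable def DiffPlus (r : WithTop ℕ∞) : Subgroup HomeoPlus where
  carrier := {f | ContDiffOn ℝ r (ext f) (Icc 0 1) ∧ ContDiffOn ℝ r (ext f⁻¹) (Icc 0 1)}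
  one_mem' := by
    have h : ContDiffOn ℝ r (ext 1) (Icc 0 1) := contDiffOn_id.congr fun x hx => ext_one hx
    exact ⟨h, by rwa [inv_one]⟩
  mul_mem' := by
    rintro f g ⟨hf, hf'⟩ ⟨hg, hg'⟩
    refine ⟨(hf.comp hg (ext_mapsTo g)).congr fun x hx => ext_mul f g hx, ?_⟩
    rw [mul_inv_rev]
    exact (hg'.comp hf' (ext_mapsTo f⁻¹)).congr fun x hx => ext_mul _ _ hx
  inv_mem' := by
    rintro f ⟨hf, hf'⟩
    exact ⟨hf', by rwa [inv_inv]⟩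

/-- The derivative of `f` on `[0,1]` (one-sided at the endpoints). -/
noncomputable def derivI (f : HomeoPlus) : ℝ → ℝ := derivWithin (ext f) (Icc 0 1)

theorem derivI_mul {f g : HomeoPlus} (hf : f ∈ DiffPlus 1) (hg : g ∈ DiffPlus 1) :
    EqOn (derivI (f * g)) (fun x => derivI f (ext g x) * derivI g x) (Icc 0 1) := by
  intro x hx
  have hu : UniqueDiffWithinAt ℝ (Icc (0 : ℝ) 1) x := uniqueDiffOn_Icc_zero_one x hx
  have h1 : derivI (f * g) x = derivWithin (ext f ∘ ext g) (Icc 0 1) x :=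
    derivWithin_congr (fun y hy => ext_mul f g hy) (ext_mul f g hx)
  rw [h1]
  exact derivWithin_comp x ((hf.1.differentiableOn one_ne_zero) _ (ext_mapsTo g hx))
    ((hg.1.differentiableOn one_ne_zero) x hx) (ext_mapsTo g)

theorem derivI_mul_bv {f g : HomeoPlus} (hf : f ∈ DiffPlus 1) (hg : g ∈ DiffPlus 1)
    (hf' : BoundedVariationOn (derivI f) (Icc 0 1))
    (hg' : BoundedVariationOn (derivI g) (Icc 0 1)) :
    BoundedVariationOn (derivI (f * g)) (Icc 0 1) := by
  have h1 : BoundedVariationOn (derivI f ∘ ext g) (Icc 0 1) :=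
    ne_top_of_le_ne_top hf'
      (eVariationOn.comp_le_of_monotoneOn (derivI f) (ext g) (ext_monotone g) (ext_mapsTo g))
  have h2 := h1.mul hg'
  unfold BoundedVariationOn at *
  rw [eVariationOn.congr (derivI_mul hf hg)]
  exact h2

/-- `Diff^{1+bv}_+([0,1])`: the group of orientation-preserving `C^1` diffeomorphisms of `[0,1]`
whose derivative (and that of the inverse) has finite total variation. -/
noncomputable def DiffPlusBV : Subgroup HomeoPlus where
  carrier := {f | f ∈ DiffPlus 1 ∧ BoundedVariationOn (derivI f) (Icc 0 1) ∧
    BoundedVariationOn (derivI f⁻¹) (Icc 0 1)}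
  one_mem' := by
    have h : BoundedVariationOn (derivI 1) (Icc 0 1) := by
      have h1 : EqOn (derivI 1) (fun _ => (1 : ℝ)) (Icc 0 1) := by
        intro x hx
        have h2 : derivI 1 x = derivWithin id (Icc 0 1) x :=
          derivWithin_congr (fun y hy => ext_one hy) (ext_one hx)
        rw [h2]
        exact derivWithin_id x _ (uniqueDiffOn_Icc_zero_one x hx)
      unfold BoundedVariationOn
      rw [eVariationOn.congr h1]
      exact ((LipschitzWith.const (1 : ℝ)).lipschitzOnWith (s := univ)).comp_boundedVariationOn
        (mapsTo_univ _ _) (BoundedVariationOn.id_Icc 0 1)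
    exact ⟨one_mem _, h, by rwa [inv_one]⟩
  mul_mem' := by
    rintro f g ⟨hf, hf1, hf2⟩ ⟨hg, hg1, hg2⟩
    refine ⟨mul_mem hf hg, derivI_mul_bv hf hg hf1 hg1, ?_⟩
    rw [mul_inv_rev]
    exact derivI_mul_bv (inv_mem hg) (inv_mem hf) hg2 hf2
  inv_mem' := by
    rintro f ⟨hf, hf1, hf2⟩
    exact ⟨inv_mem hf, hf2, by rwa [inv_inv]⟩

/-- Every `C^2` diffeomorphism is of class `C^{1+bv}`. -/
theorem diffPlus_two_le : DiffPlus 2 ≤ DiffPlusBV := by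
  have key : ∀ f : HomeoPlus, ContDiffOn ℝ 2 (ext f) (Icc 0 1) →
      BoundedVariationOn (derivI f) (Icc 0 1) := by
    intro f hf
    have h1 : ContDiffOn ℝ 1 (derivI f) (Icc 0 1) :=
      hf.derivWithin uniqueDiffOn_Icc_zero_one (by norm_num)
    obtain ⟨K, hK⟩ := h1.exists_lipschitzOnWith one_ne_zero (convex_Icc 0 1) isCompact_Icc
    exact hK.comp_boundedVariationOn (mapsTo_id _) (BoundedVariationOn.id_Icc 0 1)
  intro f hf
  exact ⟨⟨hf.1.of_le (by norm_num), hf.2.of_le (by norm_num)⟩, key f hf.1, key f⁻¹ hf.2⟩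

section Distortion

variable {G : Type*} [Group G]

/-- The word length of `g` with respect to `S`: the least length of a word in the elements of `S`
and their inverses that represents `g`. It is only used when `S` generates the group. -/
noncomputable def wordLength (S : Set G) (g : G) : ℕ :=
  sInf {n | ∃ l : List G, l.length = n ∧ (∀ s ∈ l, s ∈ S ∨ s⁻¹ ∈ S) ∧ l.prod = g}

/-- `g` is distorted in the finitely generated group `G`: it is a non-torsion element and, for a
finite generating system, the word length of `g ^ n` grows sublinearly in `n`. -/
def IsDistortedInFG (g : G) : Prop :=
  ¬ IsOfFinOrder g ∧ ∃ S : Set G, S.Finite ∧ Subgroup.closure S = ⊤ ∧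
    Tendsto (fun n : ℕ => (wordLength S (g ^ n) : ℝ) / (n : ℝ)) atTop (𝓝 0)

/-- `g` is a distorted element of `G`: it is distorted inside some finitely generated subgroup. -/
def IsDistortedElement (g : G) : Prop :=
  ∃ H : Subgroup G, H.FG ∧ ∃ hg : g ∈ H, IsDistortedInFG (⟨g, hg⟩ : H)

end Distortion

/-- `φ t x` is the (complete) flow on the interval `J` of the vector field `X`. -/
structure IsFlowOn (J : Set ℝ) (X : ℝ → ℝ) (φ : ℝ → ℝ → ℝ) : Prop where
  mem : ∀ x ∈ J, ∀ t, φ t x ∈ J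
  zero : ∀ x ∈ J, φ 0 x = x
  hasDerivAt : ∀ x ∈ J, ∀ t, HasDerivAt (fun s => φ s x) (X (φ t x)) t

/-- `X` is a `C^1` vector field on the interval `J`, with flow `φ`, and the time-`1` map of the
flow is `f` (restricted to `J`). -/
def GeneratesOn (J : Set ℝ) (f : HomeoPlus) (X : ℝ → ℝ) (φ : ℝ → ℝ → ℝ) : Prop :=
  ContDiffOn ℝ 1 X J ∧ IsFlowOn J X φ ∧ ∀ x ∈ J, φ 1 x = ext f x

/-- `f` is the time-`1` map of the flow of a `C^1` vector field on `[0,1]`. -/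
def IsTimeOneMap (f : HomeoPlus) : Prop :=
  ∃ X φ, GeneratesOn (Icc 0 1) f X φ

/-- `f` has no fixed point in the interior of `[0,1]`. -/
def NoInteriorFixedPoint (f : HomeoPlus) : Prop :=
  ∀ x ∈ Ioo (0 : ℝ) 1, ext f x ≠ x

/-- The Mather invariant of `f`, as the class of all its representatives (lifted to the real line).
Let `X` and `Y` be the generating vector fields of `f`, of class `C^1` on `[0,1)` and on `(0,1]`,
with flows `φ` and `ψ`. For `a b ∈ (0,1)` the representative `M^{a,b}` is
`(t ↦ ψ t b)⁻¹ ∘ (t ↦ φ t a) : ℝ → ℝ`; it commutes with the unit translation, so it is the lift of a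
circle diffeomorphism. Changing `a` and `b` amounts to composing with translations on both sides,
so the set of all these maps is one class modulo rotations on both sides. -/
def matherInvariant (f : HomeoPlus) : Set (ℝ → ℝ) :=
  {M | ∃ X φ Y ψ, GeneratesOn (Ico 0 1) f X φ ∧ GeneratesOn (Ioc 0 1) f Y ψ ∧
    ∃ a ∈ Ioo (0 : ℝ) 1, ∃ b ∈ Ioo (0 : ℝ) 1, ∀ t, ψ (M t) b = φ t a}

/-- The class of rotations (lifted to the real line). -/
def rotationClass : Set (ℝ → ℝ) := {M | ∃ c : ℝ, ∀ t, M t = t + c}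

/-- The Mather invariant of `f` is trivial if it is the class of rotations. -/
def HasTrivialMatherInvariant (f : HomeoPlus) : Prop := matherInvariant f = rotationClass

/-! ### Integral curves on the line -/

/-! Total variation of `log D` is subadditive under composition and finite on `DiffPlusBV`, so for a
distorted element the variation of `log D(f ^ n)` is at most a constant times the word length of `f
^ n`, hence o(n) (`exists_logVariation_pow_le`). Everything follows from this sublinearity.

At a fixed point, `log D(f ^ n)` is `n log Df`, so `Df = 1` there, and `f` extends by the identity
to a parabolic diffeomorphism `F` of the line. Its Szekeres field `X`, the limit of `disp F (F ^ n
x) / D(F ^ n)(x)`, exists because the distortions along an orbit are dominated by its displacements,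
whose absolute values sum to at most 1. It satisfies `X ∘ F = DF · X`, is C¹ off the fixed points,
and gives `∫ 1 / X = 1` from `x` to `F x`. Its derivative at `x` is controlled by the total
displacement of the forward orbit, hence is small near a fixed point which that orbit approaches.
The field of `F⁻¹` has the same property for backward orbits.

The crux is `tsum_logD_pow_sub_eq`. If the total distortion between two points of one fundamental
domain differed in the past and in the future, then `log D(F ^ N)` would oscillate by a fixed amount
on about `N` disjoint intervals, and its variation would grow linearly. So the fields of `F` and
`F⁻¹` are opposite (`szekeres_inv`), `X` is C¹ at the fixed points from both sides, and `F` is the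
time-1 map of its flow. This is the second assertion.

For the first, Kopell's argument (`GeneratesOn.eq_szekeres`) shows that any C¹ generator on `[0,1)`
or `(0,1]` equals `X` on `(0,1)`. The two flows therefore agree, and the Mather invariant consists
of translations. -/

theorem integralCurve_unique {J : Set ℝ} (hJ : J.OrdConnected) {Z : ℝ → ℝ}
    (hZ : ContDiffOn ℝ 1 Z J) {γ₁ γ₂ : ℝ → ℝ}
    (h₁ : ∀ t, HasDerivAt γ₁ (Z (γ₁ t)) t) (m₁ : ∀ t, γ₁ t ∈ J)
    (h₂ : ∀ t, HasDerivAt γ₂ (Z (γ₂ t)) t) (m₂ : ∀ t, γ₂ t ∈ J) (h0 : γ₁ 0 = γ₂ 0) :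
    γ₁ = γ₂ := by
  have c₁ : Continuous γ₁ := continuous_iff_continuousAt.2 fun t => (h₁ t).continuousAt
  have c₂ : Continuous γ₂ := continuous_iff_continuousAt.2 fun t => (h₂ t).continuousAt
  funext t
  set T := |t| + 1 with hT
  have hTpos : 0 < T := by positivity
  -- `Z` is only locally Lipschitz on `J`. Over a bounded time both curves stay in a compact
  -- interval inside `J`, where a Lipschitz constant exists.
  set C : Set ℝ := γ₁ '' Icc (-T) T ∪ γ₂ '' Icc (-T) T
  have hC : IsCompact C := (isCompact_Icc.image c₁).union (isCompact_Icc.image c₂)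
  have hCne : C.Nonempty := ⟨γ₁ 0, Or.inl ⟨0, by constructor <;> linarith, rfl⟩⟩
  obtain ⟨c, hc⟩ := hC.exists_isLeast hCne
  obtain ⟨d, hd⟩ := hC.exists_isGreatest hCne
  have hCJ : C ⊆ J := by
    rintro _ (⟨s, -, rfl⟩ | ⟨s, -, rfl⟩)
    exacts [m₁ s, m₂ s]
  have hcd : Icc c d ⊆ J := hJ.out (hCJ hc.1) (hCJ hd.1)
  obtain ⟨L, hL⟩ := (hZ.mono hcd).exists_lipschitzOnWith one_ne_zero (convex_Icc c d) isCompact_Icc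
  have k₁ : ∀ s ∈ Ioo (-T) T, γ₁ s ∈ Icc c d := fun s hs =>
    ⟨hc.2 (Or.inl ⟨s, Ioo_subset_Icc_self hs, rfl⟩), hd.2 (Or.inl ⟨s, Ioo_subset_Icc_self hs, rfl⟩)⟩
  have k₂ : ∀ s ∈ Ioo (-T) T, γ₂ s ∈ Icc c d := fun s hs =>
    ⟨hc.2 (Or.inr ⟨s, Ioo_subset_Icc_self hs, rfl⟩), hd.2 (Or.inr ⟨s, Ioo_subset_Icc_self hs, rfl⟩)⟩
  have := ODE_solution_unique_of_mem_Ioo (v := fun _ => Z) (s := fun _ => Icc c d) (K := L)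
    (a := -T) (b := T) (t₀ := 0) (f := γ₁) (g := γ₂)
    (fun _ _ => hL) ⟨by linarith, hTpos⟩ (fun s hs => ⟨h₁ s, k₁ s hs⟩)
    (fun s hs => ⟨h₂ s, k₂ s hs⟩) h0
  exact this ⟨by linarith [neg_abs_le t], by linarith [le_abs_self t]⟩

/-- As `Z` is bounded and globally Lipschitz, Picard–Lindelöf applies on every `[-T, T]` at once,
with radius `L * T`; the solutions are then glued by uniqueness. -/
theorem exists_integralCurve {Z : ℝ → ℝ} {K L : NNReal} (hZ : LipschitzWith K Z)
    (hL : ∀ x, ‖Z x‖ ≤ L) (x : ℝ) : ∃ γ : ℝ → ℝ, γ 0 = x ∧ ∀ t, HasDerivAt γ (Z (γ t)) t := by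
  have loc : ∀ T : ℝ, 0 < T → ∃ γ : ℝ → ℝ, γ 0 = x ∧
      ∀ t ∈ Ioo (-T) T, HasDerivAt γ (Z (γ t)) t := by
    intro T hT
    have h0 : (0 : ℝ) ∈ Icc (-T) T := ⟨by linarith, hT.le⟩
    have hPL : IsPicardLindelof (fun _ => Z) (tmin := -T) (tmax := T) ⟨0, h0⟩ x
        (L * T.toNNReal) 0 L K := by
      refine IsPicardLindelof.of_time_independent (fun y _ => hL y) hZ.lipschitzOnWith ?_
      simp only [sub_neg_eq_add, zero_add, sub_zero, max_self, NNReal.coe_zero, NNReal.coe_mul,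
        Real.coe_toNNReal _ hT.le, le_refl]
    obtain ⟨γ, g0, hγ⟩ := hPL.exists_eq_forall_mem_Icc_hasDerivWithinAt₀
    exact ⟨γ, g0, fun t ht => (hγ t (Ioo_subset_Icc_self ht)).hasDerivAt (Icc_mem_nhds ht.1 ht.2)⟩
  choose! γ g0 hγ using loc
  have agree : ∀ S T : ℝ, 0 < S → S ≤ T → EqOn (γ S) (γ T) (Ioo (-S) S) := by
    intro S T hS hST
    refine ODE_solution_unique_of_mem_Ioo (v := fun _ => Z) (s := fun _ => univ) (K := K)
      (t₀ := 0) (fun _ _ => hZ.lipschitzOnWith) ⟨by linarith, hS⟩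
      (fun s hs => ⟨hγ S hS s hs, mem_univ _⟩)
      (fun s hs => ⟨hγ T (by linarith) s ⟨by linarith [hs.1], by linarith [hs.2]⟩, mem_univ _⟩) ?_
    rw [g0 S hS, g0 T (by linarith)]
  refine ⟨fun t => γ (|t| + 1) t, g0 _ (by positivity), fun t => ?_⟩
  have hd := hγ (|t| + 2) (by positivity) t
    ⟨by linarith [neg_abs_le t], by linarith [le_abs_self t]⟩
  have e0 : γ (|t| + 1) t = γ (|t| + 2) t := agree _ _ (by positivity) (by linarith)
    ⟨by linarith [neg_abs_le t], by linarith [le_abs_self t]⟩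
  simp only [e0]
  refine hd.congr_of_eventuallyEq ?_
  have : ∀ᶠ s in 𝓝 t, |s| < |t| + 1 :=
    (continuous_abs.tendsto t).eventually (gt_mem_nhds (by linarith))
  filter_upwards [this] with s hs
  exact agree _ _ (by positivity) (by linarith)
    ⟨by linarith [neg_abs_le s], by linarith [le_abs_self s]⟩

/-- The degenerate case `a = b` is included, so that a vanishing integral of a nowhere zero function
can be used to conclude `a = b`. -/
theorem exists_intervalIntegral_eq_mul {g : ℝ → ℝ} {a b : ℝ} (hg : ContinuousOn g (uIcc a b)) :
    ∃ c ∈ uIcc a b, ∫ x in a..b, g x = g c * (b - a) := by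
  rcases eq_or_ne a b with rfl | hab
  · exact ⟨a, left_mem_uIcc, by simp⟩
  · obtain ⟨c, hc, h⟩ := exists_eq_interval_average hab hg
    refine ⟨c, uIoo_subset_uIcc_self hc, ?_⟩
    rw [h, interval_average_eq_div, div_mul_cancel₀ _ (sub_ne_zero.2 hab.symm)]

theorem exists_sub_eq_mul_of_hasDerivAt {g g' : ℝ → ℝ} {a b : ℝ}
    (hg : ∀ x ∈ uIcc a b, HasDerivAt g (g' x) x) :
    ∃ c ∈ uIcc a b, g b - g a = g' c * (b - a) := by
  wlog hab : a ≤ b generalizing a b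
  · obtain ⟨c, hc, h⟩ := this (a := b) (b := a) (by rwa [uIcc_comm]) (by linarith)
    exact ⟨c, by rwa [uIcc_comm], by linarith⟩
  rcases hab.eq_or_lt with rfl | hlt
  · exact ⟨a, left_mem_uIcc, by simp⟩
  rw [uIcc_of_le hab] at hg ⊢
  obtain ⟨c, hc, h⟩ := exists_hasDerivAt_eq_slope g g' hlt
    (fun x hx => (hg x hx).continuousAt.continuousWithinAt)
    (fun x hx => hg x (Ioo_subset_Icc_self hx))
  exact ⟨c, Ioo_subset_Icc_self hc, by rw [h, div_mul_cancel₀ _ (by linarith)]⟩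

/-- Along an integral curve of `Z` that avoids the zeros of `Z`, time is the integral of `1 / Z`. -/
theorem integral_inv_along_curve {Z γ : ℝ → ℝ} {s : Set ℝ} (hZ : ContinuousOn Z s)
    (hne : ∀ y ∈ s, Z y ≠ 0) (hγ : ∀ t, HasDerivAt γ (Z (γ t)) t) (hmem : ∀ t, γ t ∈ s) (T : ℝ) :
    ∫ y in γ 0..γ T, (Z y)⁻¹ = T := by
  have c : Continuous γ := continuous_iff_continuousAt.2 fun t => (hγ t).continuousAt
  have himg : ∀ S : Set ℝ, γ '' S ⊆ s := by
    rintro S _ ⟨t, -, rfl⟩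
    exact hmem t
  have := intervalIntegral.integral_comp_mul_deriv' (a := 0) (b := T) (f := γ)
    (f' := fun t => Z (γ t)) (g := fun y => (Z y)⁻¹) (fun t _ => hγ t)
    ((hZ.comp c.continuousOn (fun t _ => hmem t)))
    ((hZ.inv₀ hne).mono (himg _))
  rw [← this]
  have e : ∀ t, ((fun y => (Z y)⁻¹) ∘ γ) t * Z (γ t) = 1 := fun t =>
    inv_mul_cancel₀ (hne _ (hmem t))
  simp only [e, intervalIntegral.integral_const, sub_zero, smul_eq_mul, mul_one]

/-! ### Parabolic diffeomorphisms of the line supported in the unit interval -/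

/-- The logarithm of the derivative. -/
noncomputable def logD (F : ℝ ≃o ℝ) (x : ℝ) : ℝ := Real.log (deriv F x)

/-- The displacement function. -/
def disp (F : ℝ ≃o ℝ) (x : ℝ) : ℝ := F x - x

/-- The logarithm of the derivative of the `n`-th iterate. -/
noncomputable def logDSum (F : ℝ ≃o ℝ) (n : ℕ) (x : ℝ) : ℝ :=
  ∑ k ∈ Finset.range n, logD F ((F ^ k) x)

/-- A diffeomorphism of the line, supported in `[0,1]`, with derivative `1` at every fixed point,
with Lipschitz logarithmic derivative and of class `C^2` outside its fixed points. -/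
structure IsParabolic (K : NNReal) (F : ℝ ≃o ℝ) : Prop where
  differentiable : Differentiable ℝ F
  deriv_pos : ∀ x, 0 < deriv F x
  lipschitz : LipschitzWith K (logD F)
  deriv_fixed : ∀ x, F x = x → deriv F x = 1
  fixed_of_notMem : ∀ x, x ∉ Ioo (0 : ℝ) 1 → F x = x
  contDiffAt : ∀ x, F x ≠ x → ContDiffAt ℝ 1 (logD F) x

theorem OrderIso.uIcc_map (F : ℝ ≃o ℝ) {x a b : ℝ} (hx : x ∈ uIcc a b) :
    F x ∈ uIcc (F a) (F b) := by
  rcases le_total a b with h | h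
  · rw [uIcc_of_le h] at hx
    rw [uIcc_of_le (F.monotone h)]
    exact ⟨F.monotone hx.1, F.monotone hx.2⟩
  · rw [uIcc_of_ge h] at hx
    rw [uIcc_of_ge (F.monotone h)]
    exact ⟨F.monotone hx.1, F.monotone hx.2⟩

theorem pow_succ_apply' (F : ℝ ≃o ℝ) (n : ℕ) (x : ℝ) : (F ^ (n + 1)) x = F ((F ^ n) x) := by
  rw [pow_succ']
  rfl

theorem pow_succ_apply (F : ℝ ≃o ℝ) (n : ℕ) (x : ℝ) : (F ^ (n + 1)) x = (F ^ n) (F x) := by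
  rw [pow_succ]
  rfl

theorem pow_zero_apply (F : ℝ ≃o ℝ) (x : ℝ) : (F ^ 0) x = x := rfl

theorem pow_apply_fixed {F : ℝ ≃o ℝ} {x : ℝ} (hx : F x = x) (n : ℕ) : (F ^ n) x = x := by
  induction n with
  | zero => rfl
  | succ n ih => rw [pow_succ_apply', ih, hx]

theorem apply_pow_eq_iff (F : ℝ ≃o ℝ) (n : ℕ) (x : ℝ) : F ((F ^ n) x) = (F ^ n) x ↔ F x = x := by
  rw [← pow_succ_apply', pow_succ_apply, (F ^ n).injective.eq_iff]

theorem inv_apply_apply (F : ℝ ≃o ℝ) (x : ℝ) : F⁻¹ (F x) = x := F.symm_apply_apply x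

theorem apply_inv_apply (F : ℝ ≃o ℝ) (x : ℝ) : F (F⁻¹ x) = x := F.apply_symm_apply x

theorem inv_apply_eq_self_iff (F : ℝ ≃o ℝ) (x : ℝ) : F⁻¹ x = x ↔ F x = x := by
  constructor <;> intro h
  · conv_lhs => rw [← h]
    exact apply_inv_apply F x
  · conv_lhs => rw [← h]
    exact inv_apply_apply F x

theorem disp_eq_zero_iff {F : ℝ ≃o ℝ} {x : ℝ} : disp F x = 0 ↔ F x = x := sub_eq_zero

/-- Orbits are monotone or antitone. -/
theorem monotone_or_antitone_orbit (F : ℝ ≃o ℝ) (x : ℝ) :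
    Monotone (fun n : ℕ => (F ^ n) x) ∨ Antitone (fun n : ℕ => (F ^ n) x) := by
  rcases le_total x (F x) with h | h
  · left
    refine monotone_nat_of_le_succ fun n => ?_
    rw [pow_succ_apply]
    exact (F ^ n).monotone h
  · right
    refine antitone_nat_of_succ_le fun n => ?_
    rw [pow_succ_apply]
    exact (F ^ n).monotone h

/-- The orbit is monotone, so its displacements have constant sign and telescope. All summability
below rests on this. -/
theorem sum_abs_disp (F : ℝ ≃o ℝ) (x : ℝ) (n : ℕ) :
    ∑ k ∈ Finset.range n, |disp F ((F ^ k) x)| = |(F ^ n) x - x| := by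
  have e : ∀ k, disp F ((F ^ k) x) = (F ^ (k + 1)) x - (F ^ k) x := fun k => by
    rw [pow_succ_apply']
    rfl
  rcases monotone_or_antitone_orbit F x with h | h
  · have : ∀ k, |disp F ((F ^ k) x)| = (F ^ (k + 1)) x - (F ^ k) x := fun k => by
      rw [e, abs_of_nonneg (sub_nonneg.2 (h k.le_succ))]
    simp only [this]
    rw [Finset.sum_range_sub (fun k => (F ^ k) x), pow_zero_apply, abs_of_nonneg]
    exact sub_nonneg.2 (h n.zero_le)
  · have : ∀ k, |disp F ((F ^ k) x)| = -(F ^ (k + 1)) x - -(F ^ k) x := fun k => by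
      rw [e, abs_of_nonpos (sub_nonpos.2 (h k.le_succ))]
      ring
    simp only [this]
    rw [Finset.sum_range_sub (fun k => -(F ^ k) x), pow_zero_apply, abs_of_nonpos]
    · ring
    · exact sub_nonpos.2 (h n.zero_le)

namespace IsParabolic

variable {K : NNReal} {F : ℝ ≃o ℝ}

theorem hasDerivAt (h : IsParabolic K F) (x : ℝ) : HasDerivAt F (Real.exp (logD F x)) x := by
  rw [logD, Real.exp_log (h.deriv_pos x)]
  exact (h.differentiable x).hasDerivAt

theorem logD_fixed (h : IsParabolic K F) {x : ℝ} (hx : F x = x) : logD F x = 0 := by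
  rw [logD, h.deriv_fixed x hx, Real.log_one]

theorem abs_logD_sub_le (h : IsParabolic K F) (x y : ℝ) : |logD F x - logD F y| ≤ K * |x - y| := by
  simpa [Real.dist_eq] using h.lipschitz.dist_le_mul x y

theorem abs_logD_le (h : IsParabolic K F) (x : ℝ) : |logD F x| ≤ K := by
  by_cases hx : x ∈ Ioo (0 : ℝ) 1
  · have h1 := h.abs_logD_sub_le x 0
    rw [h.logD_fixed (h.fixed_of_notMem 0 (by simp)), sub_zero, sub_zero,
      abs_of_pos hx.1] at h1
    exact h1.trans (mul_le_of_le_one_right K.2 hx.2.le)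
  · rw [h.logD_fixed (h.fixed_of_notMem x hx), abs_zero]
    exact K.2

theorem continuous_logD (h : IsParabolic K F) : Continuous (logD F) := h.lipschitz.continuous

theorem mem_Ioo_of_ne (h : IsParabolic K F) {x : ℝ} (hx : F x ≠ x) : x ∈ Ioo (0 : ℝ) 1 := by
  by_contra hc
  exact hx (h.fixed_of_notMem x hc)

theorem mem_Ioo_pow (h : IsParabolic K F) {x : ℝ} (hx : F x ≠ x) (n : ℕ) :
    (F ^ n) x ∈ Ioo (0 : ℝ) 1 :=
  h.mem_Ioo_of_ne (mt (apply_pow_eq_iff F n x).1 hx)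

theorem abs_pow_sub_le (h : IsParabolic K F) (x : ℝ) (n : ℕ) : |(F ^ n) x - x| ≤ 1 := by
  by_cases hx : F x = x
  · simp [pow_apply_fixed hx]
  · have h1 := h.mem_Ioo_pow hx n
    have h2 := h.mem_Ioo_of_ne hx
    rw [abs_le]
    constructor <;> linarith [h1.1, h1.2, h2.1, h2.2]

theorem summable_disp (h : IsParabolic K F) (x : ℝ) :
    Summable fun k : ℕ => |disp F ((F ^ k) x)| :=
  summable_of_sum_range_le (fun _ => abs_nonneg _) (c := 1) fun n => by
    rw [sum_abs_disp]
    exact h.abs_pow_sub_le x n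

theorem tsum_disp_le (h : IsParabolic K F) (x : ℝ) : ∑' k : ℕ, |disp F ((F ^ k) x)| ≤ 1 :=
  (h.summable_disp x).tsum_le_of_sum_range_le fun n => by
    rw [sum_abs_disp]
    exact h.abs_pow_sub_le x n

/-- If the orbit of `x` moves towards the fixed point `q`, its total displacement is bounded by the
distance to `q`. -/
theorem tsum_disp_le_abs_sub (h : IsParabolic K F) {x q : ℝ} (hq : F q = q)
    (hx : x ≤ F x ∧ x ≤ q ∨ F x ≤ x ∧ q ≤ x) :
    ∑' k : ℕ, |disp F ((F ^ k) x)| ≤ |x - q| :=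
  (h.summable_disp x).tsum_le_of_sum_range_le fun n => by
    rw [sum_abs_disp]
    rcases hx with ⟨h1, h2⟩ | ⟨h1, h2⟩
    · have a : (F ^ n) x ≤ q := by
        rw [← pow_apply_fixed hq n]
        exact (F ^ n).monotone h2
      have b : x ≤ (F ^ n) x := by
        have : Monotone (fun n : ℕ => (F ^ n) x) := monotone_nat_of_le_succ fun n => by
          rw [pow_succ_apply]
          exact (F ^ n).monotone h1
        exact this n.zero_le
      rw [abs_of_nonneg (by linarith), abs_of_nonpos (by linarith)]
      linarith
    · have a : q ≤ (F ^ n) x := by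
        rw [← pow_apply_fixed hq n]
        exact (F ^ n).monotone h2
      have b : (F ^ n) x ≤ x := by
        have : Antitone (fun n : ℕ => (F ^ n) x) := antitone_nat_of_succ_le fun n => by
          rw [pow_succ_apply]
          exact (F ^ n).monotone h1
        exact this n.zero_le
      rw [abs_of_nonpos (by linarith), abs_of_nonneg (by linarith)]
      linarith

theorem exists_tendsto_orbit (h : IsParabolic K F) (x : ℝ) :
    ∃ p, F p = p ∧ Tendsto (fun n : ℕ => (F ^ n) x) atTop (𝓝 p) := by
  have hb : ∀ n, |(F ^ n) x - x| ≤ 1 := h.abs_pow_sub_le x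
  have key : ∃ p, Tendsto (fun n : ℕ => (F ^ n) x) atTop (𝓝 p) := by
    rcases monotone_or_antitone_orbit F x with hm | hm
    · refine ⟨_, tendsto_atTop_ciSup hm ⟨x + 1, ?_⟩⟩
      rintro _ ⟨n, rfl⟩
      linarith [(abs_le.1 (hb n)).2]
    · refine ⟨_, tendsto_atTop_ciInf hm ⟨x - 1, ?_⟩⟩
      rintro _ ⟨n, rfl⟩
      linarith [(abs_le.1 (hb n)).1]
  obtain ⟨p, hp⟩ := key
  refine ⟨p, ?_, hp⟩
  have h1 : Tendsto (fun n : ℕ => (F ^ (n + 1)) x) atTop (𝓝 p) := (tendsto_add_atTop_iff_nat 1).2 hp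
  have h2 : Tendsto (fun n : ℕ => F ((F ^ n) x)) atTop (𝓝 (F p)) :=
    (F.continuous.tendsto p).comp hp
  simp only [pow_succ_apply'] at h1
  exact tendsto_nhds_unique h2 h1

theorem hasDerivAt_pow (h : IsParabolic K F) (n : ℕ) (x : ℝ) :
    HasDerivAt (fun y => (F ^ n) y) (Real.exp (logDSum F n x)) x := by
  induction n with
  | zero => simpa [logDSum] using! hasDerivAt_id x
  | succ n ih =>
    have h1 := (h.hasDerivAt ((F ^ n) x)).comp x ih
    rw [← Real.exp_add, add_comm] at h1
    simp only [pow_succ_apply', logDSum, Finset.sum_range_succ]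
    exact h1

/-- Mean value theorem for a parabolic diffeomorphism. -/
theorem exists_sub_eq (h : IsParabolic K F) (a b : ℝ) :
    ∃ c ∈ uIcc a b, F b - F a = Real.exp (logD F c) * (b - a) :=
  exists_sub_eq_mul_of_hasDerivAt fun x _ => h.hasDerivAt x

theorem exists_disp_sub_eq (h : IsParabolic K F) (a b : ℝ) :
    ∃ c ∈ uIcc a b, disp F b - disp F a = (Real.exp (logD F c) - 1) * (b - a) := by
  obtain ⟨c, hc, e⟩ := h.exists_sub_eq a b
  exact ⟨c, hc, by rw [disp, disp, sub_mul, ← e]; ring⟩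

theorem exists_disp_apply_eq (h : IsParabolic K F) (x : ℝ) :
    ∃ c ∈ uIcc x (F x), disp F (F x) = Real.exp (logD F c) * disp F x :=
  h.exists_sub_eq x (F x)

theorem hasDerivAt_inv (h : IsParabolic K F) (x : ℝ) :
    HasDerivAt (F⁻¹ : ℝ ≃o ℝ) (Real.exp (logD F (F⁻¹ x)))⁻¹ x :=
  HasDerivAt.of_local_left_inverse (f := F) (g := (F⁻¹ : ℝ ≃o ℝ))
    (F⁻¹ : ℝ ≃o ℝ).continuous.continuousAt (h.hasDerivAt (F⁻¹ x))
    (Real.exp_ne_zero _) (Eventually.of_forall fun y => apply_inv_apply F y)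

theorem logD_inv (h : IsParabolic K F) (x : ℝ) : logD F⁻¹ x = -logD F (F⁻¹ x) := by
  rw [logD, (h.hasDerivAt_inv x).deriv, Real.log_inv, Real.log_exp]

/-- Transfers every forward-orbit estimate to backward orbits. The constant comes from `log DF⁻¹ =
-log DF ∘ F⁻¹` and `|log DF| ≤ K`, which makes `F⁻¹` Lipschitz with constant `exp K`. -/
theorem inv (h : IsParabolic K F) : IsParabolic (K * (Real.exp K).toNNReal) F⁻¹ := by
  have hd := h.hasDerivAt_inv
  have hlog := h.logD_inv
  have hlip : LipschitzWith (Real.exp K).toNNReal (F⁻¹ : ℝ ≃o ℝ) := by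
    refine lipschitzWith_of_nnnorm_deriv_le (fun x => (hd x).differentiableAt) fun x => ?_
    rw [← NNReal.coe_le_coe, coe_nnnorm, Real.coe_toNNReal _ (Real.exp_pos _).le, (hd x).deriv, ← Real.exp_neg, Real.norm_eq_abs,
      Real.abs_exp]
    exact Real.exp_le_exp.2 (by linarith [(abs_le.1 (h.abs_logD_le (F⁻¹ x))).1])
  refine ⟨fun x => (hd x).differentiableAt, fun x => ?_, ?_, fun x hx => ?_, fun x hx => ?_,
    fun x hx => ?_⟩
  · rw [(hd x).deriv]
    positivity
  · have : logD F⁻¹ = fun x => -logD F (F⁻¹ x) := funext hlog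
    rw [this]
    exact (h.lipschitz.comp hlip).neg
  · have hx' := hx
    rw [(hd x).deriv, hx, h.logD_fixed ((inv_apply_eq_self_iff F x).1 hx')]
    simp
  · exact (inv_apply_eq_self_iff F x).2 (h.fixed_of_notMem x hx)
  · have : logD F⁻¹ = fun x => -logD F (F⁻¹ x) := funext hlog
    rw [this]
    have hx' : F (F⁻¹ x) ≠ F⁻¹ x := by
      rw [apply_inv_apply]
      exact fun hc => hx hc.symm
    have hinv : ContDiffAt ℝ 1 (F⁻¹ : ℝ ≃o ℝ) x := by
      refine contDiffAt_one_iff.2 ⟨fun y => ContinuousLinearMap.toSpanSingleton ℝ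
        (Real.exp (logD F (F⁻¹ y)))⁻¹, univ, univ_mem, ?_, fun y _ => (hd y).hasFDerivAt⟩
      refine Continuous.continuousOn ?_
      refine (ContinuousLinearMap.toSpanSingletonCLE (𝕜 := ℝ) (E := ℝ)).continuous.comp ?_
      refine Continuous.inv₀ ?_ fun y => Real.exp_ne_zero _
      exact Real.continuous_exp.comp (h.continuous_logD.comp F⁻¹.continuous)
    exact ((h.contDiffAt _ hx').comp x hinv).neg

end IsParabolic

/-! ### The Szekeres vector field -/

/-- The distortion of `F` between `x` and `F x`. -/
noncomputable def distortion (F : ℝ ≃o ℝ) (x : ℝ) : ℝ :=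
  Real.log (disp F (F x) / disp F x) - logD F x

/-- The Szekeres vector field `lim disp F (F ^ n x) / D (F ^ n) x`. -/
noncomputable def szekeres (F : ℝ ≃o ℝ) (x : ℝ) : ℝ :=
  disp F x * Real.exp (∑' k : ℕ, distortion F ((F ^ k) x))

theorem logDSum_succ (F : ℝ ≃o ℝ) (n : ℕ) (x : ℝ) :
    logDSum F (n + 1) x = logDSum F n x + logD F ((F ^ n) x) :=
  Finset.sum_range_succ _ _

theorem pow_add_apply (F : ℝ ≃o ℝ) (m n : ℕ) (x : ℝ) : (F ^ (m + n)) x = (F ^ m) ((F ^ n) x) := by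
  rw [pow_add]
  rfl

theorem abs_sub_le_abs_sub_of_mem_uIcc {a b c d : ℝ} (hc : c ∈ uIcc a b) (hd : d ∈ uIcc a b) :
    |c - d| ≤ |b - a| := by
  rcases le_total a b with h | h
  · rw [uIcc_of_le h] at hc hd
    rw [abs_of_nonneg (sub_nonneg.2 h), abs_le]
    constructor <;> linarith [hc.1, hc.2, hd.1, hd.2]
  · rw [uIcc_of_ge h] at hc hd
    rw [abs_of_nonpos (sub_nonpos.2 h), abs_le]
    constructor <;> linarith [hc.1, hc.2, hd.1, hd.2]

namespace IsParabolic

variable {K : NNReal} {F : ℝ ≃o ℝ}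

/-- By the mean value theorem the quotient of successive displacements is `DF(c)` with `c` between
`x` and `F x`. At a fixed point the conventions `0 / 0 = 0` and `log 0 = 0` make the distortion
vanish. -/
theorem abs_distortion_le (h : IsParabolic K F) (x : ℝ) : |distortion F x| ≤ K * |disp F x| := by
  by_cases hx : F x = x
  · simp [distortion, hx, disp, h.logD_fixed hx]
  · obtain ⟨c, hc, e⟩ := h.exists_disp_apply_eq x
    have hne : disp F x ≠ 0 := mt disp_eq_zero_iff.1 hx
    rw [distortion, e, mul_div_cancel_right₀ _ hne, Real.log_exp]
    refine (h.abs_logD_sub_le c x).trans (mul_le_mul_of_nonneg_left ?_ K.2)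
    exact abs_sub_le_abs_sub_of_mem_uIcc hc left_mem_uIcc

theorem disp_mul_exp_distortion (h : IsParabolic K F) (x : ℝ) :
    disp F x * Real.exp (distortion F x) = disp F (F x) * Real.exp (-logD F x) := by
  by_cases hx : F x = x
  · simp [hx, disp]
  · obtain ⟨c, -, e⟩ := h.exists_disp_apply_eq x
    have hne : disp F x ≠ 0 := mt disp_eq_zero_iff.1 hx
    rw [distortion, e, mul_div_cancel_right₀ _ hne, Real.log_exp, sub_eq_add_neg, Real.exp_add]
    ring

theorem summable_distortion (h : IsParabolic K F) (x : ℝ) :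
    Summable fun k : ℕ => distortion F ((F ^ k) x) :=
  Summable.of_norm_bounded ((h.summable_disp x).mul_left (K : ℝ)) fun k =>
    h.abs_distortion_le ((F ^ k) x)

theorem abs_tsum_distortion_le (h : IsParabolic K F) (x : ℝ) :
    |∑' k : ℕ, distortion F ((F ^ k) x)| ≤ K * ∑' k : ℕ, |disp F ((F ^ k) x)| := by
  rw [← tsum_mul_left, ← Real.norm_eq_abs]
  exact tsum_of_norm_bounded ((h.summable_disp x).mul_left (K : ℝ)).hasSum fun k =>
    h.abs_distortion_le ((F ^ k) x)

theorem abs_tsum_distortion_le' (h : IsParabolic K F) (x : ℝ) :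
    |∑' k : ℕ, distortion F ((F ^ k) x)| ≤ K :=
  (h.abs_tsum_distortion_le x).trans (mul_le_of_le_one_right K.2 (h.tsum_disp_le x))

theorem abs_szekeres_le (h : IsParabolic K F) (x : ℝ) :
    |szekeres F x| ≤ Real.exp K * |disp F x| := by
  rw [szekeres, abs_mul, Real.abs_exp, mul_comm]
  gcongr
  exact (le_abs_self _).trans (h.abs_tsum_distortion_le' x)

theorem szekeres_eq_zero_iff {x : ℝ} : szekeres F x = 0 ↔ F x = x := by
  rw [szekeres, mul_eq_zero, disp_eq_zero_iff]
  simp [Real.exp_ne_zero]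

/-- Passing from `x` to `F x` drops the first term of the distortion series, which is exactly what
relates `disp F x` to `disp F (F x)`. -/
theorem szekeres_apply (h : IsParabolic K F) (x : ℝ) :
    szekeres F (F x) = Real.exp (logD F x) * szekeres F x := by
  have e : ∑' k : ℕ, distortion F ((F ^ k) x) =
      distortion F x + ∑' k : ℕ, distortion F ((F ^ k) (F x)) := by
    rw [(h.summable_distortion x).tsum_eq_zero_add]
    simp only [pow_succ_apply, pow_zero_apply]
  rw [szekeres, szekeres, e, Real.exp_add, ← mul_assoc (disp F x), h.disp_mul_exp_distortion,
    Real.exp_neg]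
  field_simp

theorem szekeres_pow_apply (h : IsParabolic K F) (x : ℝ) (n : ℕ) :
    szekeres F ((F ^ n) x) = Real.exp (logDSum F n x) * szekeres F x := by
  induction n with
  | zero => simp [logDSum]
  | succ n ih =>
    rw [pow_succ_apply', h.szekeres_apply, ih, logDSum_succ, Real.exp_add]
    ring

theorem disp_mul_exp_sum_distortion (h : IsParabolic K F) (x : ℝ) (n : ℕ) :
    disp F x * Real.exp (∑ k ∈ Finset.range n, distortion F ((F ^ k) x)) =
      disp F ((F ^ n) x) * Real.exp (-logDSum F n x) := by
  induction n with
  | zero => simp [logDSum]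
  | succ n ih =>
    rw [Finset.sum_range_succ, Real.exp_add, ← mul_assoc, ih, logDSum_succ,
      neg_add, Real.exp_add, mul_right_comm, h.disp_mul_exp_distortion, pow_succ_apply']
    ring

/-- The partial products telescope, which identifies the exponential formula with the classical
limit. -/
theorem tendsto_szekeres (h : IsParabolic K F) (x : ℝ) :
    Tendsto (fun n => disp F ((F ^ n) x) * Real.exp (-logDSum F n x)) atTop
      (𝓝 (szekeres F x)) := by
  simp only [← h.disp_mul_exp_sum_distortion]
  exact ((Real.continuous_exp.tendsto _).comp
    (h.summable_distortion x).hasSum.tendsto_sum_nat).const_mul _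

theorem abs_pow_two_sub_le (h : IsParabolic K F) (x : ℝ) (n : ℕ) :
    |(F ^ (n + 2)) x - (F ^ n) x| ≤ (1 + Real.exp K) * |disp F ((F ^ n) x)| := by
  set y := (F ^ n) x
  have e : (F ^ (n + 2)) x - y = disp F (F y) + disp F y := by
    rw [pow_succ_apply', pow_succ_apply', disp, disp]
    ring
  obtain ⟨c, -, hc⟩ := h.exists_disp_apply_eq y
  rw [e, hc, ← add_one_mul, abs_mul, add_comm 1]
  gcongr
  rw [abs_of_pos (by positivity)]
  gcongr
  exact (le_abs_self _).trans (h.abs_logD_le c)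

theorem tendsto_of_mem_uIcc {x p : ℝ}
    (hp : Tendsto (fun n : ℕ => (F ^ n) x) atTop (𝓝 p)) {ξ : ℕ → ℝ}
    (hξ : ∀ n, ξ n ∈ uIcc ((F ^ n) x) ((F ^ (n + 2)) x)) : Tendsto ξ atTop (𝓝 p) := by
  have h2 : Tendsto (fun n : ℕ => (F ^ (n + 2)) x) atTop (𝓝 p) :=
    (tendsto_add_atTop_iff_nat (f := fun n : ℕ => (F ^ n) x) 2).2 hp
  refine tendsto_of_tendsto_of_tendsto_of_le_of_le (g := fun n => min ((F ^ n) x) ((F ^ (n + 2)) x))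
    (h := fun n => max ((F ^ n) x) ((F ^ (n + 2)) x)) ?_ ?_ (fun n => (hξ n).1) (fun n => (hξ n).2)
  · simpa using hp.min h2
  · simpa using hp.max h2

/-- The displacement changes over the interval by `DF(c) - 1`, which tends to 0 because the limit
fixed point is parabolic, times a length at most `1 + exp K` times the displacement itself. -/
theorem tendsto_disp_ratio (h : IsParabolic K F) {x : ℝ} (hx : F x ≠ x) {ξ : ℕ → ℝ}
    (hξ : ∀ n, ξ n ∈ uIcc ((F ^ n) x) ((F ^ (n + 2)) x)) :
    Tendsto (fun n => disp F (ξ n) / disp F ((F ^ n) x)) atTop (𝓝 1) := by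
  obtain ⟨p, hp, hlim⟩ := h.exists_tendsto_orbit x
  choose c hc e using fun n => h.exists_disp_sub_eq ((F ^ n) x) (ξ n)
  have hc' : ∀ n, c n ∈ uIcc ((F ^ n) x) ((F ^ (n + 2)) x) := fun n =>
    uIcc_subset_uIcc left_mem_uIcc (hξ n) (hc n)
  have hclim := tendsto_of_mem_uIcc hlim hc'
  have h0 : Tendsto (fun n => |Real.exp (logD F (c n)) - 1| * (1 + Real.exp K)) atTop (𝓝 0) := by
    have h1 : Tendsto (fun n => logD F (c n)) atTop (𝓝 0) := by
      rw [← h.logD_fixed hp]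
      exact (h.continuous_logD.tendsto p).comp hclim
    have h2 := (((Real.continuous_exp.tendsto 0).comp h1).sub_const 1).abs.mul_const
      (1 + Real.exp K)
    simpa using! h2
  refine tendsto_iff_norm_sub_tendsto_zero.2 (squeeze_zero (fun _ => norm_nonneg _) (fun n => ?_) h0)
  have hne : disp F ((F ^ n) x) ≠ 0 := by
    rw [Ne, disp_eq_zero_iff, apply_pow_eq_iff]
    exact hx
  rw [Real.norm_eq_abs, div_sub_one hne, e, abs_div, abs_mul, mul_div_assoc]
  gcongr
  rw [div_le_iff₀ (abs_pos.2 hne)]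
  exact (abs_sub_le_abs_sub_of_mem_uIcc (hξ n) left_mem_uIcc).trans (h.abs_pow_two_sub_le x n)

theorem tsum_disp_eq (h : IsParabolic K F) {x p : ℝ}
    (hp : Tendsto (fun n : ℕ => (F ^ n) x) atTop (𝓝 p)) :
    ∑' k : ℕ, |disp F ((F ^ k) x)| = |x - p| := by
  refine tendsto_nhds_unique (h.summable_disp x).hasSum.tendsto_sum_nat ?_
  simp only [sum_abs_disp, abs_sub_comm x p]
  exact (hp.sub_const x).abs

/-- The orbit of `ξ n` is squeezed between two shifts of the orbit of `x`, so it has the same limit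
`p` and total displacement `|ξ n - p|`. -/
theorem tendsto_tsum_distortion (h : IsParabolic K F) {x p : ℝ}
    (hlim : Tendsto (fun n : ℕ => (F ^ n) x) atTop (𝓝 p)) {ξ : ℕ → ℝ}
    (hξ : ∀ n, ξ n ∈ uIcc ((F ^ n) x) ((F ^ (n + 2)) x)) :
    Tendsto (fun n => ∑' k : ℕ, distortion F ((F ^ k) (ξ n))) atTop (𝓝 0) := by
  have hξlim := tendsto_of_mem_uIcc hlim hξ
  have h0 : Tendsto (fun n => K * |ξ n - p|) atTop (𝓝 0) := by
    simpa using ((hξlim.sub_const p).abs.const_mul (K : ℝ))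
  refine squeeze_zero_norm (fun n => ?_) h0
  refine (h.abs_tsum_distortion_le _).trans (mul_le_mul_of_nonneg_left ?_ K.2)
  refine (h.tsum_disp_eq (tendsto_of_mem_uIcc (F := F) (x := (F ^ n) x) ?_ fun k => ?_)).le
  · simp only [← pow_add_apply]
    exact (tendsto_add_atTop_iff_nat (f := fun n : ℕ => (F ^ n) x) n).2 hlim
  · have := OrderIso.uIcc_map (F ^ k) (hξ n)
    have e : (F ^ (k + 2)) ((F ^ n) x) = (F ^ k) ((F ^ (n + 2)) x) := by
      rw [← pow_add_apply, ← pow_add_apply, add_assoc, add_comm 2]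
    rwa [e]

end IsParabolic

/-! ### Regularity and normalisation of the Szekeres field off the fixed points -/

/-- The derivative of the Szekeres vector field. -/
noncomputable def szekeresDeriv (F : ℝ ≃o ℝ) (x : ℝ) : ℝ :=
  -∑' k : ℕ, deriv (logD F) ((F ^ k) x) * szekeres F ((F ^ k) x)

theorem ContDiffAt.continuousAt_deriv_of_one {g : ℝ → ℝ} {x : ℝ} (hg : ContDiffAt ℝ 1 g x) :
    ContinuousAt (deriv g) x := by
  obtain ⟨u, hu, hgu⟩ := hg.contDiffOn' le_rfl (by simp)
  have h1 : ContDiffOn ℝ 1 g u := by simpa using hgu.2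
  exact ((h1.continuousOn_deriv_of_isOpen hu le_rfl).continuousAt (hu.mem_nhds hgu.1))

/-- Two steps of the orbit are used instead of one so that every non-fixed point `x` is interior to
such an interval, namely the one from `F⁻¹ x` to `F x`. -/
theorem pow_mem_uIcc (F : ℝ ≃o ℝ) {x y : ℝ} (hy : y ∈ uIcc x ((F ^ 2) x)) (n : ℕ) :
    (F ^ n) y ∈ uIcc ((F ^ n) x) ((F ^ (n + 2)) x) := by
  rw [pow_add_apply]
  exact OrderIso.uIcc_map (F ^ n) hy

theorem uIcc_apply_subset (F : ℝ ≃o ℝ) (x : ℝ) : uIcc x (F x) ⊆ uIcc x ((F ^ 2) x) := by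
  refine uIcc_subset_uIcc left_mem_uIcc ?_
  have e : (F ^ 2) x = F (F x) := by rw [pow_succ_apply', pow_succ_apply', pow_zero_apply]
  rw [e]
  rcases le_total x (F x) with h | h
  · have h2 := F.monotone h
    rw [uIcc_of_le (h.trans h2)]
    exact ⟨h, h2⟩
  · have h2 := F.monotone h
    rw [uIcc_of_ge (h2.trans h)]
    exact ⟨h2, h⟩

theorem apply_ne_of_mem_uIcc {F : ℝ ≃o ℝ} {x y : ℝ} (hx : F x ≠ x) (hy : y ∈ uIcc x ((F ^ 2) x)) :
    F y ≠ y := by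
  intro hc
  have e : (F ^ 2) x = F (F x) := by rw [pow_succ_apply', pow_succ_apply', pow_zero_apply]
  rw [e] at hy
  rcases lt_or_gt_of_ne hx with h | h
  · have h1 := F.strictMono h
    have h2 := F.strictMono h1
    rw [uIcc_of_ge (h1.trans h).le] at hy
    have h3 := F.monotone (F.monotone hy.2)
    rw [hc, hc] at h3
    have h4 : y = F (F x) := le_antisymm h3 hy.1
    rw [← h4, hc] at h2
    exact lt_irrefl _ h2
  · have h1 := F.strictMono h
    have h2 := F.strictMono h1
    rw [uIcc_of_le (h.trans h1).le] at hy
    have h3 := F.monotone (F.monotone hy.1)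
    rw [hc, hc] at h3
    have h4 : y = F (F x) := le_antisymm hy.2 h3
    rw [← h4, hc] at h2
    exact lt_irrefl _ h2

namespace IsParabolic

variable {K : NNReal} {F : ℝ ≃o ℝ}

theorem abs_logD_pow_sub_le (h : IsParabolic K F) {x y : ℝ} (hy : y ∈ uIcc x ((F ^ 2) x)) (k : ℕ) :
    |logD F ((F ^ k) y) - logD F ((F ^ k) x)| ≤
      K * (1 + Real.exp K) * |disp F ((F ^ k) x)| := by
  refine (h.abs_logD_sub_le _ _).trans ?_
  rw [mul_assoc]
  refine mul_le_mul_of_nonneg_left ?_ K.2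
  exact (abs_sub_le_abs_sub_of_mem_uIcc (pow_mem_uIcc F hy k) left_mem_uIcc).trans
    (h.abs_pow_two_sub_le x k)

theorem summable_logD_pow_sub (h : IsParabolic K F) {x y : ℝ} (hy : y ∈ uIcc x ((F ^ 2) x)) :
    Summable fun k : ℕ => logD F ((F ^ k) y) - logD F ((F ^ k) x) :=
  Summable.of_norm_bounded ((h.summable_disp x).mul_left (K * (1 + Real.exp K)))
    (h.abs_logD_pow_sub_le hy)

theorem abs_logDSum_sub_le (h : IsParabolic K F) {x y : ℝ} (hy : y ∈ uIcc x ((F ^ 2) x)) (n : ℕ) :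
    |logDSum F n y - logDSum F n x| ≤ K * (1 + Real.exp K) := by
  rw [logDSum, logDSum, ← Finset.sum_sub_distrib]
  refine (Finset.abs_sum_le_sum_abs _ _).trans ?_
  refine (Finset.sum_le_sum fun k _ => h.abs_logD_pow_sub_le hy k).trans ?_
  rw [← Finset.mul_sum, sum_abs_disp]
  exact mul_le_of_le_one_right (by positivity) (h.abs_pow_sub_le x n)

/-- In the quotient of the limit formulas at `y` and `x` the displacements cancel asymptotically and
only the derivatives of `F ^ n` remain. Unlike the definition, this form can be differentiated term
by term. -/
theorem szekeres_eq_mul_exp (h : IsParabolic K F) {x y : ℝ} (hx : F x ≠ x)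
    (hy : y ∈ uIcc x ((F ^ 2) x)) :
    szekeres F y = szekeres F x *
      Real.exp (-∑' k : ℕ, (logD F ((F ^ k) y) - logD F ((F ^ k) x))) := by
  refine tendsto_nhds_unique (h.tendsto_szekeres y) ?_
  have h1 := (h.tendsto_disp_ratio hx (pow_mem_uIcc F hy)).mul (h.tendsto_szekeres x)
  have h2 := (Real.continuous_exp.tendsto _).comp
    (h.summable_logD_pow_sub hy).hasSum.tendsto_sum_nat.neg
  rw [one_mul] at h1
  refine (h1.mul h2).congr fun n => ?_
  have hne : disp F ((F ^ n) x) ≠ 0 := by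
    rw [Ne, disp_eq_zero_iff, apply_pow_eq_iff]
    exact hx
  simp only [Function.comp, Finset.sum_sub_distrib]
  change _ * Real.exp (-(logDSum F n y - logDSum F n x)) = _
  rw [neg_sub, sub_eq_add_neg, Real.exp_add, Real.exp_neg (logDSum F n x)]
  field_simp

/-- Invariance gives `D(F ^ n)(x) = X(F ^ n x) / X(x)`, and bounded distortion carries the estimate
over to `y`. The bound is summable, hence a majorant for the differentiated series. -/
theorem exp_logDSum_le (h : IsParabolic K F) {x y : ℝ} (hx : F x ≠ x)
    (hy : y ∈ uIcc x ((F ^ 2) x)) (n : ℕ) :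
    Real.exp (logDSum F n y) ≤ Real.exp (K * (1 + Real.exp K)) *
      (Real.exp K / |szekeres F x|) * |disp F ((F ^ n) x)| := by
  have hX : 0 < |szekeres F x| := abs_pos.2 (mt szekeres_eq_zero_iff.1 hx)
  have h1 : Real.exp (logDSum F n y) ≤
      Real.exp (K * (1 + Real.exp K)) * Real.exp (logDSum F n x) := by
    rw [← Real.exp_add]
    exact Real.exp_le_exp.2 (by linarith [(abs_le.1 (h.abs_logDSum_sub_le hy n)).2])
  have h2 : Real.exp (logDSum F n x) * |szekeres F x| ≤ Real.exp K * |disp F ((F ^ n) x)| := by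
    have := h.abs_szekeres_le ((F ^ n) x)
    rwa [h.szekeres_pow_apply, abs_mul, Real.abs_exp] at this
  refine h1.trans ?_
  rw [mul_assoc]
  refine mul_le_mul_of_nonneg_left ?_ (Real.exp_pos _).le
  rw [div_mul_eq_mul_div, le_div_iff₀ hX]
  exact h2

theorem abs_deriv_logD_le (h : IsParabolic K F) (x : ℝ) : |deriv (logD F) x| ≤ K :=
  norm_deriv_le_of_lipschitz h.lipschitz

theorem pow_apply_ne {x : ℝ} (hx : F x ≠ x) (n : ℕ) : F ((F ^ n) x) ≠ (F ^ n) x :=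
  mt (apply_pow_eq_iff F n x).1 hx

theorem szekeresDeriv_eq (h : IsParabolic K F) (x : ℝ) :
    szekeresDeriv F x =
      -(szekeres F x * ∑' k : ℕ, deriv (logD F) ((F ^ k) x) * Real.exp (logDSum F k x)) := by
  rw [szekeresDeriv, ← tsum_mul_left]
  congr 2
  funext k
  rw [h.szekeres_pow_apply]
  ring

theorem hasDerivAt_szekeres_of_mem (h : IsParabolic K F) {x y : ℝ} (hx : F x ≠ x)
    (hy : y ∈ uIoo x ((F ^ 2) x)) : HasDerivAt (szekeres F) (szekeresDeriv F y) y := by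
  have hsub : uIoo x ((F ^ 2) x) ⊆ uIcc x ((F ^ 2) x) := uIoo_subset_uIcc_self
  have hopen : IsOpen (uIoo x ((F ^ 2) x)) := isOpen_Ioo
  have hconn : IsPreconnected (uIoo x ((F ^ 2) x)) := isPreconnected_Ioo
  have hu := (h.summable_disp x).mul_left
    (K * (Real.exp (K * (1 + Real.exp K)) * (Real.exp K / |szekeres F x|)))
  have hW := hasDerivAt_tsum_of_isPreconnected (g := fun (k : ℕ) z =>
      logD F ((F ^ k) z) - logD F ((F ^ k) x))
    (g' := fun k z => deriv (logD F) ((F ^ k) z) * Real.exp (logDSum F k z))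
    hu hopen hconn ?_ ?_ hy (h.summable_logD_pow_sub (hsub hy)) hy
  · have h1 := (hW.neg.exp).const_mul (szekeres F x)
    have h2 := h1.congr_of_eventuallyEq (f₁ := szekeres F) (by
      filter_upwards [hopen.mem_nhds hy] with z hz
      exact h.szekeres_eq_mul_exp hx (hsub hz))
    convert! h2 using 1
    rw [h.szekeresDeriv_eq, h.szekeres_eq_mul_exp hx (hsub hy), ← mul_assoc, mul_neg]
    rfl
  · intro k z hz
    have hz' := pow_apply_ne (apply_ne_of_mem_uIcc hx (hsub hz)) k
    exact (((h.contDiffAt _ hz').differentiableAt one_ne_zero).hasDerivAt.comp z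
      (h.hasDerivAt_pow k z)).sub_const _
  · intro k z hz
    rw [norm_mul, Real.norm_eq_abs, Real.norm_eq_abs, Real.abs_exp, mul_assoc (K : ℝ)]
    exact mul_le_mul (h.abs_deriv_logD_le _) (h.exp_logDSum_le hx (hsub hz) k)
      (Real.exp_pos _).le K.2

theorem continuousOn_szekeresDeriv_of_ne (h : IsParabolic K F) {x : ℝ} (hx : F x ≠ x) :
    ContinuousOn (szekeresDeriv F) (uIoo x ((F ^ 2) x)) := by
  have hsub : uIoo x ((F ^ 2) x) ⊆ uIcc x ((F ^ 2) x) := uIoo_subset_uIcc_self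
  have hX : ContinuousOn (szekeres F) (uIoo x ((F ^ 2) x)) := fun y hy =>
    (h.hasDerivAt_szekeres_of_mem hx hy).continuousAt.continuousWithinAt
  have hu := (h.summable_disp x).mul_left
    (K * (Real.exp (K * (1 + Real.exp K)) * (Real.exp K / |szekeres F x|)))
  have hS : ContinuousOn (fun y => ∑' k : ℕ, deriv (logD F) ((F ^ k) y) *
      Real.exp (logDSum F k y)) (uIoo x ((F ^ 2) x)) := by
    refine continuousOn_tsum (fun k => ?_) hu fun k z hz => ?_
    · intro z hz
      have hz' := pow_apply_ne (apply_ne_of_mem_uIcc hx (hsub hz)) k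
      refine ContinuousAt.continuousWithinAt (ContinuousAt.mul ?_ ?_)
      · exact ContinuousAt.comp (g := deriv (logD F)) (h.contDiffAt _ hz').continuousAt_deriv_of_one
          (F ^ k).continuous.continuousAt
      · refine (Real.continuous_exp.comp ?_).continuousAt
        exact continuous_finsetSum _ fun i _ => h.continuous_logD.comp (F ^ i).continuous
    · rw [norm_mul, Real.norm_eq_abs, Real.norm_eq_abs, Real.abs_exp, mul_assoc (K : ℝ)]
      exact mul_le_mul (h.abs_deriv_logD_le _) (h.exp_logDSum_le hx (hsub hz) k)
        (Real.exp_pos _).le K.2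
  refine (hX.mul hS).neg.congr fun y _ => h.szekeresDeriv_eq y

theorem mem_uIoo_inv {x : ℝ} (hx : F x ≠ x) : x ∈ uIoo (F⁻¹ x) ((F ^ 2) (F⁻¹ x)) := by
  have e : (F ^ 2) (F⁻¹ x) = F x := by
    rw [pow_succ_apply', pow_succ_apply', pow_zero_apply, apply_inv_apply]
  rw [e]
  rcases lt_or_gt_of_ne hx with hlt | hlt
  · have h1 : x < F⁻¹ x := by simpa [inv_apply_apply] using (F⁻¹ : ℝ ≃o ℝ).strictMono hlt
    rw [uIoo_of_ge (hlt.trans h1).le]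
    exact ⟨hlt, h1⟩
  · have h1 : F⁻¹ x < x := by simpa [inv_apply_apply] using (F⁻¹ : ℝ ≃o ℝ).strictMono hlt
    rw [uIoo_of_le (h1.trans hlt).le]
    exact ⟨h1, hlt⟩

theorem inv_apply_ne {x : ℝ} (hx : F x ≠ x) : F (F⁻¹ x) ≠ F⁻¹ x := by
  rw [apply_inv_apply]
  exact fun hc => hx ((inv_apply_eq_self_iff F x).1 hc.symm)

theorem hasDerivAt_szekeres_of_ne (h : IsParabolic K F) {x : ℝ} (hx : F x ≠ x) :
    HasDerivAt (szekeres F) (szekeresDeriv F x) x :=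
  h.hasDerivAt_szekeres_of_mem (inv_apply_ne hx) (mem_uIoo_inv hx)

theorem continuousAt_szekeresDeriv (h : IsParabolic K F) {x : ℝ} (hx : F x ≠ x) :
    ContinuousAt (szekeresDeriv F) x :=
  (h.continuousOn_szekeresDeriv_of_ne (inv_apply_ne hx)).continuousAt
    (isOpen_Ioo.mem_nhds (mem_uIoo_inv hx))

theorem continuousOn_szekeres (h : IsParabolic K F) :
    ContinuousOn (szekeres F) {x | F x ≠ x} := fun _ hx =>
  (h.hasDerivAt_szekeres_of_ne hx).continuousAt.continuousWithinAt

/-- The total displacement is kept on the right because it tends to 0 near a fixed point that the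
orbits approach. -/
theorem abs_szekeresDeriv_le (h : IsParabolic K F) (x : ℝ) :
    |szekeresDeriv F x| ≤ K * Real.exp K * ∑' k : ℕ, |disp F ((F ^ k) x)| := by
  rw [szekeresDeriv, abs_neg, ← tsum_mul_left, ← Real.norm_eq_abs]
  refine tsum_of_norm_bounded ((h.summable_disp x).mul_left (K * Real.exp K)).hasSum fun k => ?_
  rw [norm_mul, mul_assoc]
  exact mul_le_mul (h.abs_deriv_logD_le _) (h.abs_szekeres_le _) (norm_nonneg _) K.2

theorem uIcc_apply_subset_ne {x : ℝ} (hx : F x ≠ x) : uIcc x (F x) ⊆ {y | F y ≠ y} := fun _ hy =>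
  apply_ne_of_mem_uIcc hx (uIcc_apply_subset F x hy)

theorem continuousOn_inv_szekeres (h : IsParabolic K F) :
    ContinuousOn (fun y => (szekeres F y)⁻¹) {x | F x ≠ x} :=
  h.continuousOn_szekeres.inv₀ fun _ hx => mt szekeres_eq_zero_iff.1 hx

theorem integral_inv_szekeres_apply (h : IsParabolic K F) {x : ℝ} (hx : F x ≠ x) :
    ∫ y in F x..F (F x), (szekeres F y)⁻¹ = ∫ y in x..F x, (szekeres F y)⁻¹ := by
  have hsub := uIcc_apply_subset_ne hx
  have himg : F '' uIcc x (F x) ⊆ {y | F y ≠ y} := by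
    rintro _ ⟨y, hy, rfl⟩
    exact fun hc => hsub hy (F.injective hc)
  rw [← intervalIntegral.integral_comp_mul_deriv' (fun y _ => h.hasDerivAt y)
    (Real.continuous_exp.comp h.continuous_logD).continuousOn (h.continuousOn_inv_szekeres.mono himg)]
  refine intervalIntegral.integral_congr fun y hy => ?_
  have hne : szekeres F y ≠ 0 := mt szekeres_eq_zero_iff.1 (hsub hy)
  simp only [Function.comp, h.szekeres_apply]
  field_simp

/-- The flow of `X` needs time 1 from `x` to `F x`. By invariance the integral may be computed from
`F ^ n x` to `F ^ (n + 1) x`, where the mean value theorem turns it into a quotient of displacements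
times a distortion factor, both tending to 1. -/
theorem integral_inv_szekeres (h : IsParabolic K F) {x : ℝ} (hx : F x ≠ x) :
    ∫ y in x..F x, (szekeres F y)⁻¹ = 1 := by
  have hinv : ∀ n : ℕ, ∫ y in (F ^ n) x..F ((F ^ n) x), (szekeres F y)⁻¹ =
      ∫ y in x..F x, (szekeres F y)⁻¹ := by
    intro n
    induction n with
    | zero => rfl
    | succ n ih => rw [pow_succ_apply', h.integral_inv_szekeres_apply (pow_apply_ne hx n), ih]
  choose ξ hξ e using fun n : ℕ => exists_intervalIntegral_eq_mul
    (h.continuousOn_inv_szekeres.mono (uIcc_apply_subset_ne (pow_apply_ne hx n)))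
  have hξ' : ∀ n, ξ n ∈ uIcc ((F ^ n) x) ((F ^ (n + 2)) x) := fun n => by
    rw [add_comm, pow_add_apply]
    exact uIcc_apply_subset F _ (hξ n)
  obtain ⟨p, -, hp⟩ := h.exists_tendsto_orbit x
  have h1 := h.tendsto_disp_ratio hx hξ'
  have h2 := (Real.continuous_exp.tendsto _).comp (h.tendsto_tsum_distortion hp hξ')
  have h3 := (h1.mul h2).inv₀ (by simp)
  rw [Real.exp_zero, mul_one, inv_one] at h3
  refine tendsto_nhds_unique (tendsto_const_nhds.congr fun n => ?_) h3
  rw [← hinv n, e n, szekeres, disp, disp, Function.comp]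
  rw [mul_comm, ← div_eq_mul_inv, div_mul_eq_mul_div, inv_div]

end IsParabolic

/-! ### Sublinear variation and C¹ regularity at the fixed points -/

/-- The variation of `log D (F ^ n)` grows sublinearly in `n`. -/
def HasSublinearVariation (F : ℝ ≃o ℝ) : Prop :=
  ∃ v : ℕ → ℝ, Tendsto (fun n : ℕ => v n / n) atTop (𝓝 0) ∧
    ∀ n, eVariationOn (logDSum F n) (Icc 0 1) ≤ ENNReal.ofReal (v n)

theorem logDSum_succ' (F : ℝ ≃o ℝ) (n : ℕ) (x : ℝ) :
    logDSum F (n + 1) x = logD F x + logDSum F n (F x) := by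
  rw [logDSum, Finset.sum_range_succ', add_comm, logDSum]
  simp only [pow_succ_apply, pow_zero_apply]

theorem logDSum_add (F : ℝ ≃o ℝ) (m n : ℕ) (x : ℝ) :
    logDSum F (m + n) x = logDSum F m x + logDSum F n ((F ^ m) x) := by
  rw [logDSum, Finset.sum_range_add, logDSum, logDSum]
  simp only [← pow_add_apply, add_comm]

theorem pow_apply_inv_pow_apply (F : ℝ ≃o ℝ) (n : ℕ) (x : ℝ) : (F ^ n) ((F⁻¹ ^ n) x) = x := by
  rw [inv_pow]
  exact apply_inv_apply (F ^ n) x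

theorem pow_apply_inv_pow_apply_of_le (F : ℝ ≃o ℝ) {m n : ℕ} (hmn : m ≤ n) (x : ℝ) :
    (F ^ m) ((F⁻¹ ^ n) x) = (F⁻¹ ^ (n - m)) x := by
  obtain ⟨k, rfl⟩ := Nat.exists_eq_add_of_le hmn
  rw [pow_add_apply, pow_apply_inv_pow_apply, Nat.add_sub_cancel_left]

theorem eVariationOn_neg {g : ℝ → ℝ} {s : Set ℝ} : eVariationOn (-g) s = eVariationOn g s := by
  simp only [eVariationOn, Pi.neg_apply, edist_neg_neg]

namespace IsParabolic

variable {K : NNReal} {F : ℝ ≃o ℝ}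

theorem logDSum_inv (h : IsParabolic K F) (n : ℕ) (x : ℝ) :
    logDSum F⁻¹ n x = -logDSum F n ((F⁻¹ ^ n) x) := by
  induction n with
  | zero => simp [logDSum]
  | succ n ih =>
    rw [logDSum_succ, ih, logDSum_succ', h.logD_inv, pow_succ_apply', apply_inv_apply]
    ring

/-- `log D(F⁻¹ ^ n)` is, up to sign, `log D(F ^ n)` reparametrised by an increasing map of `[0,1]`
into itself. -/
theorem hasSublinearVariation_inv (h : IsParabolic K F) (hV : HasSublinearVariation F) :
    HasSublinearVariation F⁻¹ := by
  obtain ⟨v, hv, hvar⟩ := hV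
  refine ⟨v, hv, fun n => le_trans ?_ (hvar n)⟩
  have e : logDSum F⁻¹ n = -(logDSum F n ∘ (F⁻¹ ^ n : ℝ ≃o ℝ)) := funext (h.logDSum_inv n)
  rw [e, eVariationOn_neg]
  refine eVariationOn.comp_le_of_monotoneOn _ _ ((F⁻¹ ^ n).monotone.monotoneOn _) fun x hx => ?_
  have h0 := pow_apply_fixed (h.inv.fixed_of_notMem 0 (by simp)) n
  have h1 := pow_apply_fixed (h.inv.fixed_of_notMem 1 (by simp)) n
  have m0 := (F⁻¹ ^ n).monotone hx.1
  have m1 := (F⁻¹ ^ n).monotone hx.2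
  rw [h0] at m0
  rw [h1] at m1
  exact ⟨m0, m1⟩

theorem mem_uIcc_inv {x y : ℝ} (hx : x < F x) (hy : y ∈ Icc x (F x)) :
    y ∈ uIcc (F x) ((F⁻¹ ^ 2) (F x)) := by
  rw [pow_succ_apply, inv_apply_apply, pow_succ_apply, pow_zero_apply]
  have h1 : F⁻¹ x < x := by simpa [inv_apply_apply] using (F⁻¹ : ℝ ≃o ℝ).strictMono hx
  rw [uIcc_of_ge (h1.trans hx).le]
  exact ⟨h1.le.trans hy.1, hy.2⟩

theorem mem_uIcc_of_mem_Icc {x y : ℝ} (hy : y ∈ Icc x (F x)) : y ∈ uIcc x ((F ^ 2) x) :=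
  uIcc_apply_subset F x (Icc_subset_uIcc hy)

theorem summable_logD_inv_pow_sub (h : IsParabolic K F) {x y : ℝ} (hx : x < F x)
    (hy : y ∈ Icc x (F x)) :
    Summable fun k : ℕ => logD F⁻¹ ((F⁻¹ ^ k) y) - logD F⁻¹ ((F⁻¹ ^ k) x) := by
  have h1 := h.inv.summable_logD_pow_sub (mem_uIcc_inv hx hy)
  have h2 := h.inv.summable_logD_pow_sub (mem_uIcc_inv hx ⟨le_refl x, hx.le⟩)
  simpa using h1.sub h2

/-- Both `x` and `y` lie between `F x` and `F⁻² (F x)`; the formula for `F⁻¹` based at `F x` is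
applied to each, and the base point drops out. -/
theorem szekeres_inv_eq_mul_exp (h : IsParabolic K F) {x y : ℝ} (hx : x < F x)
    (hy : y ∈ Icc x (F x)) :
    szekeres F⁻¹ y = szekeres F⁻¹ x *
      Real.exp (-∑' k : ℕ, (logD F⁻¹ ((F⁻¹ ^ k) y) - logD F⁻¹ ((F⁻¹ ^ k) x))) := by
  have hne : F⁻¹ (F x) ≠ F x := by
    rw [inv_apply_apply]
    exact hx.ne
  have m1 := mem_uIcc_inv hx hy
  have m2 := mem_uIcc_inv hx ⟨le_refl x, hx.le⟩
  have e1 := h.inv.szekeres_eq_mul_exp hne m1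
  have e2 := h.inv.szekeres_eq_mul_exp hne m2
  rw [e1, e2, mul_assoc, ← Real.exp_add]
  congr 2
  rw [← neg_add, ← (h.inv.summable_logD_pow_sub m2).tsum_add (h.summable_logD_inv_pow_sub hx hy)]
  simp

/-- The `N` steps starting at `F ^ (i - N) x` split at `x` into `N - i` steps in the past and `i` in
the future. -/
theorem logDSum_sub_eq (h : IsParabolic K F) (x y : ℝ) {N i : ℕ} (hi : i ≤ N) :
    logDSum F N ((F ^ i) ((F⁻¹ ^ N) y)) - logDSum F N ((F ^ i) ((F⁻¹ ^ N) x)) =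
      ∑ k ∈ Finset.range i, (logD F ((F ^ k) y) - logD F ((F ^ k) x)) -
      ∑ k ∈ Finset.range (N - i),
        (logD F⁻¹ ((F⁻¹ ^ k) y) - logD F⁻¹ ((F⁻¹ ^ k) x)) := by
  have key : ∀ z, logDSum F N ((F ^ i) ((F⁻¹ ^ N) z)) =
      logDSum F i z - logDSum F⁻¹ (N - i) z := fun z => by
    rw [pow_apply_inv_pow_apply_of_le F hi, h.logDSum_inv]
    have e : N = (N - i) + i := by omega
    conv_lhs =>
      arg 2
      rw [e]
    rw [logDSum_add, pow_apply_inv_pow_apply]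
    ring
  rw [key, key, Finset.sum_sub_distrib, Finset.sum_sub_distrib]
  simp only [logDSum]
  ring

/-- If the variation of `log D (F ^ n)` is sublinear, the total distortion along complete orbits
is the same for all pairs of points of a fundamental domain. -/
theorem tsum_logD_pow_sub_eq (h : IsParabolic K F) (hV : HasSublinearVariation F) {x y : ℝ}
    (hx : x < F x) (hy : y ∈ Icc x (F x)) :
    ∑' k : ℕ, (logD F ((F ^ k) y) - logD F ((F ^ k) x)) =
      ∑' k : ℕ, (logD F⁻¹ ((F⁻¹ ^ k) y) - logD F⁻¹ ((F⁻¹ ^ k) x)) := by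
  obtain ⟨v, hv, hvar⟩ := hV
  by_contra hne
  set A := ∑' k : ℕ, (logD F ((F ^ k) y) - logD F ((F ^ k) x)) with hA
  set B := ∑' k : ℕ, (logD F⁻¹ ((F⁻¹ ^ k) y) - logD F⁻¹ ((F⁻¹ ^ k) x)) with hB
  obtain ⟨δ, hδ, hAB⟩ : ∃ δ > 0, |A - B| = 2 * δ :=
    ⟨|A - B| / 2, by have := abs_pos.2 (sub_ne_zero.2 hne); positivity, by ring⟩
  have tA := (h.summable_logD_pow_sub (mem_uIcc_of_mem_Icc hy)).hasSum.tendsto_sum_nat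
  have tB := (h.summable_logD_inv_pow_sub hx hy).hasSum.tendsto_sum_nat
  rw [← hA] at tA
  rw [← hB] at tB
  obtain ⟨M₁, hM₁⟩ := Metric.tendsto_atTop.1 tA (δ / 2) (by positivity)
  obtain ⟨M₂, hM₂⟩ := Metric.tendsto_atTop.1 tB (δ / 2) (by positivity)
  obtain ⟨M, hM1, hM2⟩ : ∃ M, M₁ ≤ M ∧ M₂ ≤ M := ⟨max M₁ M₂, le_max_left _ _, le_max_right _ _⟩
  have hx' : ∀ n : ℕ, (F⁻¹ ^ n) x ∈ Ioo (0 : ℝ) 1 := fun n =>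
    h.inv.mem_Ioo_pow (mt (inv_apply_eq_self_iff F x).1 hx.ne') n
  -- For `M ≤ i < N - M` both partial sums are within `δ / 2` of `A` and `B`, so `log D(F ^ N)`
  -- oscillates by at least `δ` between `F ^ i z` and `F ^ (i + 1) z`. These intervals do not
  -- overlap, so their variations add up.
  have lower : ∀ N, 2 * M < N → ((N - 2 * M : ℕ) : ℝ) * δ ≤ v N := by
    intro N hN
    set z := (F⁻¹ ^ N) x
    set w := (F⁻¹ ^ N) y
    have hzw : z ≤ w := (F⁻¹ ^ N).monotone hy.1
    have hwz : w ≤ F z := by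
      have : F z = (F⁻¹ ^ N) (F x) := by
        have hc : F * F⁻¹ ^ N = F⁻¹ ^ N * F := ((Commute.refl F).inv_right.pow_right N).eq
        exact congrArg (fun e : ℝ ≃o ℝ => e x) hc
      rw [this]
      exact (F⁻¹ ^ N).monotone hy.2
    have hmono : Monotone fun i : ℕ => (F ^ i) z := monotone_nat_of_le_succ fun i => by
      rw [pow_succ_apply]
      exact (F ^ i).monotone (hzw.trans hwz)
    have hsub : Icc ((F ^ 0) z) ((F ^ N) z) ⊆ Icc 0 1 := by
      refine Icc_subset_Icc (hx' N).1.le ?_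
      rw [pow_apply_inv_pow_apply]
      exact (hx' 0).2.le
    have h1 : ∑ i ∈ Finset.range N, eVariationOn (logDSum F N) (Icc ((F ^ i) z) ((F ^ (i + 1)) z)) ≤
        ENNReal.ofReal (v N) := by
      rw [eVariationOn.sum' (logDSum F N) hmono]
      exact (eVariationOn.mono _ hsub).trans (hvar N)
    have h2 : ∀ i ∈ Finset.Ico M (N - M), ENNReal.ofReal δ ≤
        eVariationOn (logDSum F N) (Icc ((F ^ i) z) ((F ^ (i + 1)) z)) := by
      intro i hi
      rw [Finset.mem_Ico] at hi
      have hmem : (F ^ i) w ∈ Icc ((F ^ i) z) ((F ^ (i + 1)) z) := by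
        rw [pow_succ_apply]
        exact ⟨(F ^ i).monotone hzw, (F ^ i).monotone hwz⟩
      refine le_trans ?_ (eVariationOn.edist_le (logDSum F N) hmem
        (left_mem_Icc.2 (hmono i.le_succ)))
      rw [edist_dist, Real.dist_eq, h.logDSum_sub_eq x y (by omega)]
      refine ENNReal.ofReal_le_ofReal ?_
      have a1 := hM₁ i (by omega)
      have a2 := hM₂ (N - i) (by omega)
      rw [Real.dist_eq, abs_lt] at a1 a2
      rcases abs_cases (A - B) with ⟨hc, -⟩ | ⟨hc, -⟩ <;> rw [hc] at hAB <;> rw [le_abs]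
      · left
        linarith [a1.1, a1.2, a2.1, a2.2]
      · right
        linarith [a1.1, a1.2, a2.1, a2.2]
    have h3 : ((N - 2 * M : ℕ) : ENNReal) * ENNReal.ofReal δ ≤ ENNReal.ofReal (v N) := by
      refine le_trans ?_ h1
      have hss : Finset.Ico M (N - M) ⊆ Finset.range N := fun i hi => by
        rw [Finset.mem_Ico] at hi
        rw [Finset.mem_range]
        omega
      refine le_trans ?_ (Finset.sum_le_sum_of_subset hss)
      refine le_trans ?_ (Finset.sum_le_sum h2)
      rw [Finset.sum_const, Nat.card_Ico, nsmul_eq_mul, show N - M - M = N - 2 * M by omega]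
    rw [← ENNReal.ofReal_natCast, ← ENNReal.ofReal_mul (Nat.cast_nonneg _)] at h3
    refine (ENNReal.ofReal_le_ofReal_iff'.1 h3).resolve_right (not_le.2 (mul_pos ?_ hδ))
    exact_mod_cast Nat.sub_pos_of_lt hN
  -- For `N ≥ 4 * M + 1` one has `N - 2 * M > N / 2`, so the lower bound contradicts `v N < N * δ /
  -- 2`.
  have hev := (hv.eventually (gt_mem_nhds (show (0 : ℝ) < δ / 2 by positivity))).and
    (eventually_ge_atTop (4 * M + 1))
  obtain ⟨N, hN1, hN2⟩ := hev.exists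
  have hNpos : (0 : ℝ) < N := by exact_mod_cast (by omega : 0 < N)
  rw [div_lt_iff₀ hNpos] at hN1
  have h5 := lower N (by omega)
  rw [Nat.cast_sub (by omega)] at h5
  push_cast at h5
  have h6 : (4 * M + 1 : ℝ) ≤ N := by exact_mod_cast hN2
  nlinarith

/-- Equal total distortions make the two fields proportional on `[x, F x]`. The integrals of their
inverses there are `1` and `-1`, which fixes the factor. -/
theorem szekeres_inv_of_lt (h : IsParabolic K F) (hV : HasSublinearVariation F) {x : ℝ}
    (hx : x < F x) : szekeres F⁻¹ x = -szekeres F x := by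
  have hX : szekeres F x ≠ 0 := mt szekeres_eq_zero_iff.1 hx.ne'
  have hY : szekeres F⁻¹ x ≠ 0 :=
    mt szekeres_eq_zero_iff.1 (mt (inv_apply_eq_self_iff F x).1 hx.ne')
  have hI := h.integral_inv_szekeres hx.ne'
  have hJ := h.inv.integral_inv_szekeres (x := F x) (by rw [inv_apply_apply]; exact hx.ne)
  rw [inv_apply_apply, intervalIntegral.integral_symm] at hJ
  have e : ∫ y in x..F x, (szekeres F⁻¹ y)⁻¹ =
      ∫ y in x..F x, szekeres F x / szekeres F⁻¹ x * (szekeres F y)⁻¹ := by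
    refine intervalIntegral.integral_congr fun y hy => ?_
    rw [uIcc_of_le hx.le] at hy
    have e1 := h.szekeres_eq_mul_exp hx.ne' (mem_uIcc_of_mem_Icc hy)
    have e2 := h.szekeres_inv_eq_mul_exp hx hy
    rw [← h.tsum_logD_pow_sub_eq hV hx hy] at e2
    simp only [e1, e2]
    field_simp
  rw [e, intervalIntegral.integral_const_mul, hI, mul_one] at hJ
  field_simp at hJ
  linarith

theorem szekeres_inv (h : IsParabolic K F) (hV : HasSublinearVariation F) (x : ℝ) :
    szekeres F⁻¹ x = -szekeres F x := by
  rcases lt_trichotomy x (F x) with hx | hx | hx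
  · exact h.szekeres_inv_of_lt hV hx
  · rw [szekeres_eq_zero_iff.2 hx.symm, szekeres_eq_zero_iff.2 ((inv_apply_eq_self_iff F x).2 hx.symm),
      neg_zero]
  · have hx' : x < F⁻¹ x := by simpa [inv_apply_apply] using (F⁻¹ : ℝ ≃o ℝ).strictMono hx
    have := h.inv.szekeres_inv_of_lt (h.hasSublinearVariation_inv hV) hx'
    rw [inv_inv] at this
    rw [this, neg_neg]

theorem szekeresDeriv_inv (h : IsParabolic K F) (hV : HasSublinearVariation F) {x : ℝ}
    (hx : F x ≠ x) : szekeresDeriv F⁻¹ x = -szekeresDeriv F x := by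
  have h1 := h.inv.hasDerivAt_szekeres_of_ne (mt (inv_apply_eq_self_iff F x).1 hx)
  rw [funext (h.szekeres_inv hV)] at h1
  exact h1.unique (h.hasDerivAt_szekeres_of_ne hx).neg

theorem szekeresDeriv_fixed {x : ℝ} (hx : F x = x) : szekeresDeriv F x = 0 := by
  simp [szekeresDeriv, pow_apply_fixed hx, szekeres_eq_zero_iff.2 hx]

/-- Either the forward or the backward orbit of `x` moves towards `q`. In the second case the bound
for `F⁻¹` is used, since its field is `-X`. -/
theorem exists_abs_szekeresDeriv_le (h : IsParabolic K F) (hV : HasSublinearVariation F) :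
    ∃ C : ℝ, ∀ x q, F q = q → |szekeresDeriv F x| ≤ C * |x - q| := by
  set K' := K * (Real.exp K).toNNReal
  set C := max (K * Real.exp K) (K' * Real.exp K')
  refine ⟨C, fun x q hq => ?_⟩
  by_cases hx : F x = x
  · rw [szekeresDeriv_fixed hx, abs_zero]
    positivity
  by_cases hdir : x ≤ F x ∧ x ≤ q ∨ F x ≤ x ∧ q ≤ x
  · refine (h.abs_szekeresDeriv_le x).trans ?_
    gcongr
    · exact le_max_left _ _
    · exact h.tsum_disp_le_abs_sub hq hdir
  · rw [← abs_neg, ← h.szekeresDeriv_inv hV hx]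
    refine (h.inv.abs_szekeresDeriv_le x).trans ?_
    gcongr
    · exact le_max_right _ _
    · refine h.inv.tsum_disp_le_abs_sub ((inv_apply_eq_self_iff F q).2 hq) ?_
      rcases le_total x (F x) with h1 | h1
      · right
        refine ⟨?_, ?_⟩
        · simpa [inv_apply_apply] using (F⁻¹ : ℝ ≃o ℝ).monotone h1
        · by_contra hc
          exact hdir (Or.inl ⟨h1, (not_le.1 hc).le⟩)
      · left
        refine ⟨?_, ?_⟩
        · simpa [inv_apply_apply] using (F⁻¹ : ℝ ≃o ℝ).monotone h1
        · by_contra hc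
          exact hdir (Or.inr ⟨h1, (not_le.1 hc).le⟩)

/-- At a fixed point `X` is dominated by `disp F`, whose derivative there is 0. -/
theorem hasDerivAt_szekeres (h : IsParabolic K F) (x : ℝ) :
    HasDerivAt (szekeres F) (szekeresDeriv F x) x := by
  by_cases hx : F x = x
  · rw [szekeresDeriv_fixed hx]
    have h1 : HasDerivAt (disp F) 0 x := by
      have := (h.hasDerivAt x).sub (hasDerivAt_id x)
      rw [h.logD_fixed hx, Real.exp_zero, sub_self] at this
      exact this
    rw [hasDerivAt_iff_isLittleO] at h1 ⊢
    simp only [smul_zero, sub_zero, disp_eq_zero_iff.2 hx, szekeres_eq_zero_iff.2 hx] at h1 ⊢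
    refine Asymptotics.IsBigO.trans_isLittleO (Asymptotics.IsBigO.of_bound (Real.exp K)
      (Eventually.of_forall fun y => ?_)) h1
    exact h.abs_szekeres_le y
  · exact h.hasDerivAt_szekeres_of_ne hx

theorem continuous_szekeresDeriv (h : IsParabolic K F) (hV : HasSublinearVariation F) :
    Continuous (szekeresDeriv F) := by
  refine continuous_iff_continuousAt.2 fun x => ?_
  by_cases hx : F x = x
  · obtain ⟨C, hC⟩ := h.exists_abs_szekeresDeriv_le hV
    rw [ContinuousAt, szekeresDeriv_fixed hx]
    have h0 : Tendsto (fun y => C * |y - x|) (𝓝 x) (𝓝 0) := by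
      have : Continuous fun y => C * |y - x| := by fun_prop
      simpa using this.tendsto x
    exact squeeze_zero_norm (fun y => hC y x hx) h0
  · exact h.continuousAt_szekeresDeriv hx

theorem contDiff_szekeres (h : IsParabolic K F) (hV : HasSublinearVariation F) :
    ContDiff ℝ 1 (szekeres F) := by
  rw [contDiff_one_iff_deriv]
  refine ⟨fun x => (h.hasDerivAt_szekeres x).differentiableAt, ?_⟩
  rw [funext fun x => (h.hasDerivAt_szekeres x).deriv]
  exact h.continuous_szekeresDeriv hV

end IsParabolic

/-! ### The flow of the Szekeres field -/

namespace IsParabolic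

variable {K : NNReal} {F : ℝ ≃o ℝ}

theorem exists_flow_szekeres (h : IsParabolic K F) :
    ∃ φ : ℝ → ℝ → ℝ, (∀ x, φ 0 x = x) ∧
      ∀ x t, HasDerivAt (fun s => φ s x) (szekeres F (φ t x)) t := by
  have hlip : LipschitzWith (K * (Real.exp K).toNNReal) (szekeres F) := by
    refine lipschitzWith_of_nnnorm_deriv_le
      (fun x => (h.hasDerivAt_szekeres x).differentiableAt) fun x => ?_
    rw [← NNReal.coe_le_coe, coe_nnnorm, (h.hasDerivAt_szekeres x).deriv, NNReal.coe_mul,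
      Real.coe_toNNReal _ (Real.exp_pos _).le, Real.norm_eq_abs]
    exact (h.abs_szekeresDeriv_le x).trans
      (mul_le_of_le_one_right (by positivity) (h.tsum_disp_le x))
  have hb : ∀ x, ‖szekeres F x‖ ≤ (Real.exp K).toNNReal := fun x => by
    rw [Real.coe_toNNReal _ (Real.exp_pos _).le]
    exact (h.abs_szekeres_le x).trans
      (mul_le_of_le_one_right (Real.exp_pos _).le (h.abs_pow_sub_le x 1))
  choose γ g0 hγ using fun x => exists_integralCurve hlip hb x
  exact ⟨fun t x => γ x t, g0, hγ⟩

theorem curve_eq_of_fixed (h : IsParabolic K F) (hV : HasSublinearVariation F) {γ : ℝ → ℝ}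
    (hγ : ∀ t, HasDerivAt γ (szekeres F (γ t)) t) {t₀ : ℝ} (ht : F (γ t₀) = γ t₀) (t : ℝ) :
    γ t = γ t₀ := by
  have := integralCurve_unique (J := univ) ordConnected_univ (h.contDiff_szekeres hV).contDiffOn
    (γ₁ := fun s => γ (s + t₀)) (γ₂ := fun _ => γ t₀)
    (fun s => (hγ (s + t₀)).comp_add_const s t₀) (fun _ => mem_univ _)
    (fun s => by
      rw [szekeres_eq_zero_iff.2 ht]
      exact hasDerivAt_const s _) (fun _ => mem_univ _) (by simp)
  have h1 := congrFun this (t - t₀)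
  simpa using h1

/-- Off the fixed points `1 / X` has integral 1 both from `γ 0` to `γ 1` and from `γ 0` to `F (γ
0)`; as it does not vanish in between, the endpoints agree. -/
theorem curve_one (h : IsParabolic K F) (hV : HasSublinearVariation F) {γ : ℝ → ℝ}
    (hγ : ∀ t, HasDerivAt γ (szekeres F (γ t)) t) : γ 1 = F (γ 0) := by
  by_cases hx : F (γ 0) = γ 0
  · rw [hx, h.curve_eq_of_fixed hV hγ hx]
  have hmem : ∀ t, γ t ∈ {y | F y ≠ y} := fun t hc =>
    hx (by
      have := h.curve_eq_of_fixed hV hγ hc 0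
      rw [this]
      exact hc)
  have hI := integral_inv_along_curve h.continuousOn_szekeres
    (fun y hy => mt szekeres_eq_zero_iff.1 hy) hγ hmem 1
  have hJ := h.integral_inv_szekeres hx
  have cγ : Continuous γ := continuous_iff_continuousAt.2 fun t => (hγ t).continuousAt
  have s1 : uIcc (γ 0) (γ 1) ⊆ {y | F y ≠ y} := by
    refine (intermediate_value_uIcc cγ.continuousOn).trans ?_
    rintro _ ⟨t, -, rfl⟩
    exact hmem t
  have s2 := uIcc_apply_subset_ne hx
  have s3 : uIcc (γ 1) (F (γ 0)) ⊆ {y | F y ≠ y} := by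
    refine (uIcc_subset_uIcc_union_uIcc (b := γ 0)).trans (union_subset ?_ s2)
    rwa [uIcc_comm]
  have c := h.continuousOn_inv_szekeres
  have hK := intervalIntegral.integral_add_adjacent_intervals (μ := MeasureTheory.volume)
    (c.mono s1).intervalIntegrable (c.mono s3).intervalIntegrable
  obtain ⟨z, hz, e⟩ := exists_intervalIntegral_eq_mul (c.mono s3)
  have hz0 : (szekeres F z)⁻¹ ≠ 0 := inv_ne_zero (mt szekeres_eq_zero_iff.1 (s3 hz))
  have : (szekeres F z)⁻¹ * (F (γ 0) - γ 1) = 0 := by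
    rw [← e]
    linarith
  exact (sub_eq_zero.1 ((mul_eq_zero.1 this).resolve_left hz0)).symm

end IsParabolic

/-! ### Distorted elements have sublinear variation -/

theorem eVariationOn_add_le (g₁ g₂ : ℝ → ℝ) (s : Set ℝ) :
    eVariationOn (fun x => g₁ x + g₂ x) s ≤ eVariationOn g₁ s + eVariationOn g₂ s := by
  refine iSup_le fun p => ?_
  refine le_trans (Finset.sum_le_sum fun i _ => edist_add_add_le _ _ _ _) ?_
  rw [Finset.sum_add_distrib]
  exact add_le_add (eVariationOn.sum_le p.2.2.1 p.2.2.2) (eVariationOn.sum_le p.2.2.1 p.2.2.2)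

/-- The variation of the logarithm of the derivative. -/
noncomputable def logVariation (f : HomeoPlus) : ENNReal :=
  eVariationOn (fun x => Real.log (derivI f x)) (Icc 0 1)

theorem derivI_one {x : ℝ} (hx : x ∈ Icc (0 : ℝ) 1) : derivI 1 x = 1 := by
  rw [derivI, derivWithin_congr (fun y hy => ext_one hy) (ext_one hx)]
  exact derivWithin_id x _ (uniqueDiffOn_Icc_zero_one x hx)

theorem ext_inv_ext (f : HomeoPlus) {x : ℝ} (hx : x ∈ Icc (0 : ℝ) 1) : ext f⁻¹ (ext f x) = x := by
  rw [← ext_mul _ _ hx, inv_mul_cancel, ext_one hx]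

theorem ext_ext_inv (f : HomeoPlus) {x : ℝ} (hx : x ∈ Icc (0 : ℝ) 1) : ext f (ext f⁻¹ x) = x := by
  rw [← ext_mul _ _ hx, mul_inv_cancel, ext_one hx]

theorem derivI_pos {f : HomeoPlus} (hf : f ∈ DiffPlus 1) {x : ℝ} (hx : x ∈ Icc (0 : ℝ) 1) :
    0 < derivI f x := by
  have h1 : 0 ≤ derivI f x := (ext_monotone f).derivWithin_nonneg
  have h2 := derivI_mul (inv_mem hf) hf hx
  rw [inv_mul_cancel, derivI_one hx] at h2
  refine h1.lt_of_ne fun hc => ?_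
  simp [← hc] at h2

theorem hasDerivWithinAt_ext {f : HomeoPlus} (hf : f ∈ DiffPlus 1) {x : ℝ}
    (hx : x ∈ Icc (0 : ℝ) 1) : HasDerivWithinAt (ext f) (derivI f x) (Icc 0 1) x :=
  (hf.1.differentiableOn one_ne_zero x hx).hasDerivWithinAt

theorem continuousOn_derivI {f : HomeoPlus} (hf : f ∈ DiffPlus 1) :
    ContinuousOn (derivI f) (Icc 0 1) :=
  hf.1.continuousOn_derivWithin uniqueDiffOn_Icc_zero_one le_rfl

theorem logVariation_one : logVariation 1 = 0 := by
  refine eVariationOn.constant_on ?_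
  rintro _ ⟨x, hx, rfl⟩ _ ⟨y, hy, rfl⟩
  simp only [derivI_one hx, derivI_one hy]

/-- The chain rule makes `log D` a cocycle, and a monotone reparametrisation does not increase
variation. -/
theorem logVariation_mul_le {f g : HomeoPlus} (hf : f ∈ DiffPlus 1) (hg : g ∈ DiffPlus 1) :
    logVariation (f * g) ≤ logVariation f + logVariation g := by
  have e : EqOn (fun x => Real.log (derivI (f * g) x))
      (fun x => Real.log (derivI f (ext g x)) + Real.log (derivI g x)) (Icc 0 1) := fun x hx => by
    simp only [derivI_mul hf hg hx]
    exact Real.log_mul (derivI_pos hf (ext_mapsTo g hx)).ne' (derivI_pos hg hx).ne'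
  rw [logVariation, eVariationOn.congr e]
  refine (eVariationOn_add_le _ _ _).trans (add_le_add_left ?_ _)
  exact eVariationOn.comp_le_of_monotoneOn (fun x => Real.log (derivI f x)) (ext g)
    (ext_monotone g) (ext_mapsTo g)

theorem logVariation_ne_top {f : HomeoPlus} (hf : f ∈ DiffPlusBV) : logVariation f ≠ ⊤ := by
  obtain ⟨h1, h2, -⟩ := hf
  have hne : (Icc (0 : ℝ) 1).Nonempty := ⟨0, by simp⟩
  obtain ⟨a, ha, hmin⟩ := isCompact_Icc.exists_isMinOn hne (continuousOn_derivI h1)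
  obtain ⟨b, -, hmax⟩ := isCompact_Icc.exists_isMaxOn hne (continuousOn_derivI h1)
  have hpos := derivI_pos h1 ha
  have hlog : ContDiffOn ℝ 1 Real.log (Icc (derivI f a) (derivI f b)) := fun y hy =>
    (Real.contDiffAt_log.2 (hpos.trans_le hy.1).ne').contDiffWithinAt
  obtain ⟨L, hL⟩ := hlog.exists_lipschitzOnWith one_ne_zero (convex_Icc _ _) isCompact_Icc
  exact hL.comp_boundedVariationOn (fun x hx => ⟨hmin hx, hmax hx⟩) h2

/-- Generation matters: `sInf ∅ = 0` in `ℕ`, so without a representing word the word length would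
carry no information. -/
theorem exists_list_length_eq_wordLength {G : Type*} [Group G] {S : Set G}
    (hS : Subgroup.closure S = ⊤) (g : G) :
    ∃ l : List G, l.length = wordLength S g ∧ (∀ s ∈ l, s ∈ S ∨ s⁻¹ ∈ S) ∧ l.prod = g := by
  have hne : {n | ∃ l : List G, l.length = n ∧ (∀ s ∈ l, s ∈ S ∨ s⁻¹ ∈ S) ∧ l.prod = g}.Nonempty := by
    have hg : g ∈ Submonoid.closure (S ∪ S⁻¹) := by
      rw [← Subgroup.closure_toSubmonoid, hS]
      exact Subgroup.mem_top g
    obtain ⟨l, h1, h2⟩ := Submonoid.exists_list_of_mem_closure hg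
    exact ⟨l.length, l, rfl, fun s hs => (h1 s hs).imp id Set.mem_inv.1, h2⟩
  exact Nat.sInf_mem hne

theorem exists_logVariation_pow_le {g : DiffPlusBV} (hg : IsDistortedElement g) :
    ∃ v : ℕ → ℝ, Tendsto (fun n : ℕ => v n / n) atTop (𝓝 0) ∧
      ∀ n, logVariation ((g : HomeoPlus) ^ n) ≤ ENNReal.ofReal (v n) := by
  obtain ⟨H, -, hgH, -, S, hS, hgen, hlim⟩ := hg
  set W : H → ENNReal := fun s => logVariation ((s : DiffPlusBV) : HomeoPlus)
  have hW : ∀ s, W s ≠ ⊤ := fun s => logVariation_ne_top (s : DiffPlusBV).2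
  obtain ⟨C, hC⟩ : ∃ C : NNReal, ∀ s ∈ S, W s ≤ C ∧ W s⁻¹ ≤ C := by
    refine ⟨∑ s ∈ hS.toFinset, ((W s).toNNReal + (W s⁻¹).toNNReal), fun s hs => ?_⟩
    have h1 := Finset.single_le_sum (f := fun s => (W s).toNNReal + (W s⁻¹).toNNReal)
      (fun _ _ => zero_le) (hS.mem_toFinset.2 hs)
    constructor
    · rw [← ENNReal.coe_toNNReal (hW s)]
      exact ENNReal.coe_le_coe.2 ((le_add_of_nonneg_right zero_le).trans h1)
    · rw [← ENNReal.coe_toNNReal (hW s⁻¹)]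
      exact ENNReal.coe_le_coe.2 ((le_add_of_nonneg_left zero_le).trans h1)
  have hlist : ∀ l : List H, (∀ s ∈ l, s ∈ S ∨ s⁻¹ ∈ S) → W l.prod ≤ l.length * C := by
    intro l
    induction l with
    | nil =>
      intro _
      simp only [List.prod_nil, W, Subgroup.coe_one, logVariation_one]
      exact zero_le
    | cons a l ih =>
      intro hl
      have ha : W a ≤ C := by
        rcases hl a (by simp) with h | h
        · exact (hC a h).1
        · simpa using (hC a⁻¹ h).2
      have h1 : W (a * l.prod) ≤ W a + W l.prod :=
        logVariation_mul_le (a : DiffPlusBV).2.1 (l.prod : DiffPlusBV).2.1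
      rw [List.prod_cons, List.length_cons, Nat.cast_succ, add_mul, one_mul, add_comm]
      exact h1.trans (add_le_add ha (ih fun s hs => hl s (List.mem_cons_of_mem _ hs)))
  refine ⟨fun n => wordLength S ((⟨g, hgH⟩ : H) ^ n) * C, ?_, fun n => ?_⟩
  · have := hlim.mul_const (C : ℝ)
    rw [zero_mul] at this
    refine this.congr fun n => ?_
    ring
  · obtain ⟨l, hl, hlS, hp⟩ := exists_list_length_eq_wordLength hgen ((⟨g, hgH⟩ : H) ^ n)
    have := hlist l hlS
    rw [hp, hl] at this
    rw [ENNReal.ofReal_mul (Nat.cast_nonneg _), ENNReal.ofReal_natCast, ENNReal.ofReal_coe_nnreal]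
    exact this

/-! ### Extension of diffeomorphisms of the interval to the line -/

theorem ext_zero (f : HomeoPlus) : ext f 0 = 0 := by
  have h0 : (0 : ℝ) ∈ Icc (0 : ℝ) 1 := by simp
  refine le_antisymm ?_ (ext_mapsTo f h0).1
  have h1 := ext_monotone f h0 (ext_mapsTo f⁻¹ h0) (ext_mapsTo f⁻¹ h0).1
  rwa [ext_ext_inv f h0] at h1

theorem ext_one_eq (f : HomeoPlus) : ext f 1 = 1 := by
  have h0 : (1 : ℝ) ∈ Icc (0 : ℝ) 1 := by simp
  refine le_antisymm (ext_mapsTo f h0).2 ?_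
  have h1 := ext_monotone f (ext_mapsTo f⁻¹ h0) h0 (ext_mapsTo f⁻¹ h0).2
  rwa [ext_ext_inv f h0] at h1

theorem ext_strictMonoOn (f : HomeoPlus) : StrictMonoOn (ext f) (Icc 0 1) :=
  (ext_monotone f).strictMonoOn_iff_injOn.2 fun x hx y hy hxy => by
    rw [← ext_inv_ext f hx, hxy, ext_inv_ext f hy]

open Classical in
/-- Extension of a homeomorphism of `[0,1]` by the identity. -/
noncomputable def extendFun (f : HomeoPlus) (x : ℝ) : ℝ := if x ∈ Icc (0 : ℝ) 1 then ext f x else x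

theorem extendFun_of_mem (f : HomeoPlus) {x : ℝ} (hx : x ∈ Icc (0 : ℝ) 1) :
    extendFun f x = ext f x := if_pos hx

theorem extendFun_of_le (f : HomeoPlus) {x : ℝ} (hx : x ≤ 0) : extendFun f x = x := by
  rcases hx.eq_or_lt with rfl | hlt
  · rw [extendFun_of_mem f (by simp), ext_zero]
  · exact if_neg fun hc => hlt.not_ge hc.1

theorem extendFun_of_ge (f : HomeoPlus) {x : ℝ} (hx : 1 ≤ x) : extendFun f x = x := by
  rcases hx.eq_or_lt with rfl | hlt
  · rw [extendFun_of_mem f (by simp), ext_one_eq]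
  · exact if_neg fun hc => hlt.not_ge hc.2

theorem extendFun_strictMono (f : HomeoPlus) : StrictMono (extendFun f) := by
  have h1 : StrictMonoOn (extendFun f) (Icc 0 1) := (ext_strictMonoOn f).congr fun x hx =>
    (extendFun_of_mem f hx).symm
  have h2 : StrictMonoOn (extendFun f) (Iic 0) := strictMonoOn_id.congr fun x hx =>
    (extendFun_of_le f hx).symm
  have h3 : StrictMonoOn (extendFun f) (Ici 1) := strictMonoOn_id.congr fun x hx =>
    (extendFun_of_ge f hx).symm
  have h4 := h2.union h1 isGreatest_Iic (isLeast_Icc zero_le_one)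
  rw [Iic_union_Icc_eq_Iic zero_le_one] at h4
  exact StrictMonoOn.Iic_union_Ici h4 h3

theorem extendFun_extendFun_inv (f : HomeoPlus) (x : ℝ) : extendFun f (extendFun f⁻¹ x) = x := by
  by_cases hx : x ∈ Icc (0 : ℝ) 1
  · rw [extendFun_of_mem _ hx, extendFun_of_mem _ (ext_mapsTo f⁻¹ hx), ext_ext_inv f hx]
  · simp [extendFun, hx]

/-- Extension of a homeomorphism of `[0,1]` by the identity, as a homeomorphism of the line. -/
noncomputable def extend (f : HomeoPlus) : ℝ ≃o ℝ :=
  (extendFun_strictMono f).orderIsoOfRightInverse _ (extendFun f⁻¹) (extendFun_extendFun_inv f)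

theorem extend_of_mem (f : HomeoPlus) {x : ℝ} (hx : x ∈ Icc (0 : ℝ) 1) : extend f x = ext f x :=
  extendFun_of_mem f hx

theorem extend_of_le (f : HomeoPlus) {x : ℝ} (hx : x ≤ 0) : extend f x = x :=
  extendFun_of_le f hx

theorem extend_of_ge (f : HomeoPlus) {x : ℝ} (hx : 1 ≤ x) : extend f x = x :=
  extendFun_of_ge f hx

theorem ext_pow_succ (f : HomeoPlus) (n : ℕ) {x : ℝ} (hx : x ∈ Icc (0 : ℝ) 1) :
    ext (f ^ (n + 1)) x = ext f (ext (f ^ n) x) := by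
  rw [pow_succ', ext_mul _ _ hx]

theorem extend_pow_apply (f : HomeoPlus) (n : ℕ) {x : ℝ} (hx : x ∈ Icc (0 : ℝ) 1) :
    (extend f ^ n) x = ext (f ^ n) x := by
  induction n with
  | zero => rw [pow_zero, pow_zero, ext_one hx]; rfl
  | succ n ih => rw [pow_succ_apply', ih, extend_of_mem f (ext_mapsTo _ hx), ext_pow_succ f n hx]

theorem log_derivI_pow_of_fixed {f : HomeoPlus} (hf : f ∈ DiffPlus 1) {p : ℝ}
    (hp : p ∈ Icc (0 : ℝ) 1) (hfix : ext f p = p) (n : ℕ) :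
    ext (f ^ n) p = p ∧ Real.log (derivI (f ^ n) p) = n * Real.log (derivI f p) := by
  induction n with
  | zero => simp [derivI_one hp, ext_one hp]
  | succ n ih =>
    refine ⟨by rw [ext_pow_succ f n hp, ih.1, hfix], ?_⟩
    have := derivI_mul hf (pow_mem hf n) hp
    rw [← pow_succ'] at this
    simp only [ih.1] at this
    rw [this, Real.log_mul (derivI_pos hf hp).ne' (derivI_pos (pow_mem hf n) hp).ne', ih.2]
    push_cast
    ring

theorem exists_derivI_eq_one {f : HomeoPlus} (hf : f ∈ DiffPlus 1) :
    ∃ x ∈ Icc (0 : ℝ) 1, derivI f x = 1 := by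
  obtain ⟨c, hc, e⟩ := exists_hasDerivAt_eq_slope (ext f) (derivI f) zero_lt_one
    hf.1.continuousOn fun x hx =>
      (hasDerivWithinAt_ext hf (Ioo_subset_Icc_self hx)).hasDerivAt (Icc_mem_nhds hx.1 hx.2)
  refine ⟨c, Ioo_subset_Icc_self hc, ?_⟩
  rw [e, ext_zero, ext_one_eq]
  norm_num

/-- A diffeomorphism with sublinear variation has derivative `1` at its fixed points. -/
theorem derivI_eq_one_of_fixed {f : HomeoPlus} (hf : f ∈ DiffPlus 1) {v : ℕ → ℝ}
    (hv : Tendsto (fun n : ℕ => v n / n) atTop (𝓝 0))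
    (hvar : ∀ n, logVariation (f ^ n) ≤ ENNReal.ofReal (v n)) {p : ℝ}
    (hp : p ∈ Icc (0 : ℝ) 1) (hfix : ext f p = p) : derivI f p = 1 := by
  by_contra hne
  have hpos := derivI_pos hf hp
  have hlog : Real.log (derivI f p) ≠ 0 := Real.log_ne_zero_of_pos_of_ne_one hpos hne
  have hbd : ∀ n : ℕ, 0 < n → |Real.log (derivI f p)| ≤ v n / n := by
    intro n hn
    have hn' : (0 : ℝ) < n := by exact_mod_cast hn
    -- Since `log D(f ^ n)` vanishes at some `x`, its variation is at least its absolute value at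
    -- `p`, which grows linearly.
    obtain ⟨x, hx, e⟩ := exists_derivI_eq_one (pow_mem hf n)
    have h1 := (eVariationOn.edist_le (fun x => Real.log (derivI (f ^ n) x)) hp hx).trans (hvar n)
    simp only [e, Real.log_one, (log_derivI_pow_of_fixed hf hp hfix n).2] at h1
    rw [edist_dist, Real.dist_eq, sub_zero, abs_mul, Nat.abs_cast] at h1
    rw [le_div_iff₀ hn', mul_comm]
    exact (ENNReal.ofReal_le_ofReal_iff'.1 h1).resolve_right
      (not_le.2 (mul_pos hn' (abs_pos.2 hlog)))
  have := ge_of_tendsto hv ((eventually_gt_atTop 0).mono hbd)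
  exact (abs_pos.2 hlog).not_ge this

theorem hasDerivAt_extend_of_mem_Ioo {f : HomeoPlus} (hf : f ∈ DiffPlus 1) {x : ℝ}
    (hx : x ∈ Ioo (0 : ℝ) 1) : HasDerivAt (extend f) (derivI f x) x := by
  have h1 := (hasDerivWithinAt_ext hf (Ioo_subset_Icc_self hx)).hasDerivAt (Icc_mem_nhds hx.1 hx.2)
  refine h1.congr_of_eventuallyEq ?_
  filter_upwards [Icc_mem_nhds hx.1 hx.2] with y hy using extend_of_mem f hy

/-- Derivative 1 at the endpoints is what lets the one-sided derivatives match. -/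
theorem hasDerivAt_extend {f : HomeoPlus} (hf : f ∈ DiffPlus 1) (h0 : derivI f 0 = 1)
    (h1 : derivI f 1 = 1) {x : ℝ} (hx : x ∉ Ioo (0 : ℝ) 1) : HasDerivAt (extend f) 1 x := by
  have hid : ∀ s : Set ℝ, (∀ y ∈ s, extend f y = y) → x ∈ s → HasDerivWithinAt (extend f) 1 s x :=
    fun s hs hxs => (hasDerivWithinAt_id x s).congr hs (hs x hxs)
  have hI : ∀ z ∈ Icc (0 : ℝ) 1, HasDerivWithinAt (extend f) (derivI f z) (Icc 0 1) z := fun z hz =>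
    (hasDerivWithinAt_ext hf hz).congr (fun y hy => extend_of_mem f hy) (extend_of_mem f hz)
  rcases lt_trichotomy x 0 with h | rfl | h
  · exact (hid (Iic 0) (fun y hy => extend_of_le f hy) h.le).hasDerivAt (Iic_mem_nhds h)
  · have a := hid (Iic 0) (fun y hy => extend_of_le f hy) self_mem_Iic
    have b := hI 0 (by simp)
    rw [h0] at b
    have := a.union b
    rw [Iic_union_Icc_eq_Iic zero_le_one] at this
    exact this.hasDerivAt (Iic_mem_nhds zero_lt_one)
  · have hx1 : 1 ≤ x := not_lt.1 fun hc => hx ⟨h, hc⟩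
    rcases hx1.eq_or_lt with rfl | hlt
    · have a := hid (Ici 1) (fun y hy => extend_of_ge f hy) self_mem_Ici
      have b := hI 1 (by simp)
      rw [h1] at b
      have := b.union a
      rw [Icc_union_Ici_eq_Ici zero_le_one] at this
      exact this.hasDerivAt (Ici_mem_nhds zero_lt_one)
    · exact (hid (Ici 1) (fun y hy => extend_of_ge f hy) hlt.le).hasDerivAt (Ici_mem_nhds hlt)

/-- If `f` is of class `C^2` with derivative `1` at all fixed points then its extension is a
parabolic diffeomorphism. -/
theorem exists_isParabolic_extend {f : HomeoPlus} (hf : f ∈ DiffPlus 2)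
    (hpar : ∀ p ∈ Icc (0 : ℝ) 1, ext f p = p → derivI f p = 1) :
    (∃ K, IsParabolic K (extend f)) ∧
      ∀ x ∈ Icc (0 : ℝ) 1, logD (extend f) x = Real.log (derivI f x) := by
  have hf1 : f ∈ DiffPlus 1 := ⟨hf.1.of_le (by norm_num), hf.2.of_le (by norm_num)⟩
  have h0 : derivI f 0 = 1 := hpar 0 (by simp) (ext_zero f)
  have h1 : derivI f 1 = 1 := hpar 1 (by simp) (ext_one_eq f)
  have hin : ∀ x ∈ Ioo (0 : ℝ) 1, HasDerivAt (extend f) (derivI f x) x := fun x hx =>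
    hasDerivAt_extend_of_mem_Ioo hf1 hx
  have hout : ∀ x, x ∉ Ioo (0 : ℝ) 1 → HasDerivAt (extend f) 1 x := fun x hx =>
    hasDerivAt_extend hf1 h0 h1 hx
  have hd : ∀ x ∈ Icc (0 : ℝ) 1, deriv (extend f) x = derivI f x := by
    intro x hx
    by_cases hx' : x ∈ Ioo (0 : ℝ) 1
    · exact (hin x hx').deriv
    · rw [(hout x hx').deriv]
      rcases hx.1.eq_or_lt with rfl | hlt
      · exact h0.symm
      · rw [le_antisymm hx.2 (not_lt.1 fun hc => hx' ⟨hlt, hc⟩), h1]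
  have hlog : ∀ x ∈ Icc (0 : ℝ) 1, logD (extend f) x = Real.log (derivI f x) := fun x hx => by
    rw [logD, hd x hx]
  refine ⟨?_, hlog⟩
  have hC1 : ContDiffOn ℝ 1 (fun x => Real.log (derivI f x)) (Icc 0 1) := by
    have : ContDiffOn ℝ 1 (derivI f) (Icc 0 1) :=
      hf.1.derivWithin uniqueDiffOn_Icc_zero_one (by norm_num)
    exact this.log fun x hx => (derivI_pos hf1 hx).ne'
  obtain ⟨K, hK⟩ := hC1.exists_lipschitzOnWith one_ne_zero (convex_Icc 0 1) isCompact_Icc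
  have hfixed : ∀ x, x ∉ Ioo (0 : ℝ) 1 → extend f x = x := by
    intro x hx
    rcases le_or_gt x 0 with h | h
    · exact extend_of_le f h
    · exact extend_of_ge f (not_lt.1 fun hc => hx ⟨h, hc⟩)
  refine ⟨K, fun x => ?_, fun x => ?_, ?_, fun x hx => ?_, hfixed, fun x hx => ?_⟩
  · by_cases hx : x ∈ Ioo (0 : ℝ) 1
    · exact (hin x hx).differentiableAt
    · exact (hout x hx).differentiableAt
  · by_cases hx : x ∈ Ioo (0 : ℝ) 1
    · rw [(hin x hx).deriv]
      exact derivI_pos hf1 (Ioo_subset_Icc_self hx)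
    · rw [(hout x hx).deriv]
      exact one_pos
  · have e : logD (extend f) =
        fun x => logD (extend f) (projIcc (0 : ℝ) 1 zero_le_one x : ℝ) := by
      funext x
      by_cases hx : x ∈ Icc (0 : ℝ) 1
      · rw [projIcc_of_mem _ hx]
      · have hz : ∀ y, y ∉ Ioo (0 : ℝ) 1 → logD (extend f) y = 0 := fun y hy => by
          rw [logD, (hout y hy).deriv, Real.log_one]
        rw [hz x fun hc => hx (Ioo_subset_Icc_self hc)]
        rcases le_total x 0 with h | h
        · rw [projIcc_of_le_left _ h, hz _ (by simp)]
        · rw [projIcc_of_right_le _ (not_lt.1 fun hc => hx ⟨h, hc.le⟩), hz _ (by simp)]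
    have hK' : LipschitzOnWith K (logD (extend f)) (Icc 0 1) := fun x hx y hy => by
      rw [hlog x hx, hlog y hy]
      exact hK hx hy
    rw [e]
    have := hK'.to_restrict.comp (LipschitzWith.projIcc (zero_le_one (α := ℝ)))
    rw [mul_one] at this
    exact this
  · by_cases hx' : x ∈ Icc (0 : ℝ) 1
    · rw [hd x hx']
      exact hpar x hx' (by rwa [← extend_of_mem f hx'])
    · exact (hout x fun hc => hx' (Ioo_subset_Icc_self hc)).deriv
  · have hx' : x ∈ Ioo (0 : ℝ) 1 := by
      by_contra hc
      exact hx (hfixed x hc)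
    have hmem := Icc_mem_nhds hx'.1 hx'.2
    refine ((hC1 x (Ioo_subset_Icc_self hx')).contDiffAt hmem).congr_of_eventuallyEq ?_
    filter_upwards [hmem] with y hy using hlog y hy

theorem logDSum_extend {f : HomeoPlus} (hf : f ∈ DiffPlus 1)
    (hlog : ∀ x ∈ Icc (0 : ℝ) 1, logD (extend f) x = Real.log (derivI f x)) (n : ℕ) {x : ℝ}
    (hx : x ∈ Icc (0 : ℝ) 1) : logDSum (extend f) n x = Real.log (derivI (f ^ n) x) := by
  induction n with
  | zero => simp [logDSum, derivI_one hx]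
  | succ n ih =>
    have hm := ext_mapsTo (f ^ n) hx
    rw [logDSum_succ, ih, extend_pow_apply f n hx, hlog _ hm, pow_succ',
      derivI_mul hf (pow_mem hf n) hx,
      Real.log_mul (derivI_pos hf hm).ne' (derivI_pos (pow_mem hf n) hx).ne', add_comm]

/-- A distorted element extends to a parabolic diffeomorphism with sublinear variation. -/
theorem exists_isParabolic_of_isDistortedElement {f : DiffPlus 2}
    (hf : IsDistortedElement (Subgroup.inclusion diffPlus_two_le f)) :
    (∃ K, IsParabolic K (extend (f : HomeoPlus))) ∧
      HasSublinearVariation (extend (f : HomeoPlus)) := by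
  obtain ⟨v, hv, hvar⟩ := exists_logVariation_pow_le hf
  have hf1 : (f : HomeoPlus) ∈ DiffPlus 1 := ⟨f.2.1.of_le (by norm_num), f.2.2.of_le (by norm_num)⟩
  obtain ⟨hP, hlog⟩ := exists_isParabolic_extend f.2 fun p hp hfix =>
    derivI_eq_one_of_fixed hf1 hv hvar hp hfix
  refine ⟨hP, v, hv, fun n => ?_⟩
  rw [eVariationOn.congr fun x hx => logDSum_extend hf1 hlog n hx]
  exact hvar n

/-! ### Uniqueness of the generating vector fields -/

theorem IsFlowOn.add {J : Set ℝ} (hJ : J.OrdConnected) {Z : ℝ → ℝ} {φ : ℝ → ℝ → ℝ}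
    (hZ : ContDiffOn ℝ 1 Z J) (hφ : IsFlowOn J Z φ) {x : ℝ} (hx : x ∈ J) (s t : ℝ) :
    φ (s + t) x = φ s (φ t x) := by
  have := integralCurve_unique hJ hZ (γ₁ := fun s => φ (s + t) x) (γ₂ := fun s => φ s (φ t x))
    (fun s => (hφ.hasDerivAt x hx (s + t)).comp_add_const s t) (fun s => hφ.mem x hx _)
    (fun s => hφ.hasDerivAt _ (hφ.mem x hx t) s) (fun s => hφ.mem _ (hφ.mem x hx t) s)
    (by simp [hφ.zero _ (hφ.mem x hx t)])
  exact congrFun this s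

theorem IsFlowOn.eq_of_zero {J : Set ℝ} (hJ : J.OrdConnected) {Z : ℝ → ℝ} {φ : ℝ → ℝ → ℝ}
    (hZ : ContDiffOn ℝ 1 Z J) (hφ : IsFlowOn J Z φ) {x : ℝ} (hx : x ∈ J) {t₀ : ℝ}
    (h0 : Z (φ t₀ x) = 0) (t : ℝ) : φ t x = φ t₀ x := by
  have hm := hφ.mem x hx t₀
  have := integralCurve_unique hJ hZ (γ₁ := fun s => φ s (φ t₀ x)) (γ₂ := fun _ => φ t₀ x)
    (fun s => hφ.hasDerivAt _ hm s) (fun s => hφ.mem _ hm s)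
    (fun s => by
      rw [h0]
      exact hasDerivAt_const s _) (fun _ => hm) (hφ.zero _ hm)
  have h1 := congrFun this (t - t₀)
  simp only [← hφ.add hJ hZ hx, sub_add_cancel] at h1
  exact h1

/-- `J` is `[0,1)` and `e = 0`, or `J` is `(0,1]` and `e = 1`. -/
def IsHalfOpen (J : Set ℝ) (e : ℝ) : Prop := J = Ico 0 1 ∧ e = 0 ∨ J = Ioc 0 1 ∧ e = 1

namespace IsHalfOpen

variable {J : Set ℝ} {e : ℝ}

theorem ordConnected (hJ : IsHalfOpen J e) : J.OrdConnected := by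
  rcases hJ with ⟨rfl, -⟩ | ⟨rfl, -⟩
  exacts [ordConnected_Ico, ordConnected_Ioc]

theorem mem (hJ : IsHalfOpen J e) : e ∈ J := by
  rcases hJ with ⟨rfl, rfl⟩ | ⟨rfl, rfl⟩ <;> simp

theorem subset (hJ : IsHalfOpen J e) : J ⊆ Icc 0 1 := by
  rcases hJ with ⟨rfl, -⟩ | ⟨rfl, -⟩
  exacts [Ico_subset_Icc_self, Ioc_subset_Icc_self]

theorem Ioo_subset (hJ : IsHalfOpen J e) : Ioo 0 1 ⊆ J := by
  rcases hJ with ⟨rfl, -⟩ | ⟨rfl, -⟩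
  exacts [Ioo_subset_Ico_self, Ioo_subset_Ioc_self]

theorem mem_Ioo (hJ : IsHalfOpen J e) {x : ℝ} (hx : x ∈ J) (hne : x ≠ e) : x ∈ Ioo (0 : ℝ) 1 := by
  rcases hJ with ⟨rfl, rfl⟩ | ⟨rfl, rfl⟩
  · exact ⟨hx.1.lt_of_ne hne.symm, hx.2⟩
  · exact ⟨hx.1, hx.2.lt_of_ne hne⟩

theorem notMem_Ioo (hJ : IsHalfOpen J e) : e ∉ Ioo (0 : ℝ) 1 := by
  rcases hJ with ⟨-, rfl⟩ | ⟨-, rfl⟩ <;> simp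

theorem uniqueDiffOn (hJ : IsHalfOpen J e) : UniqueDiffOn ℝ J := by
  rcases hJ with ⟨rfl, -⟩ | ⟨rfl, -⟩
  exacts [uniqueDiffOn_Ico 0 1, uniqueDiffOn_Ioc 0 1]

/-- The curve starting at `e` cannot leave `J`, so it has an extremum at time 0. -/
theorem apply_eq_zero (hJ : IsHalfOpen J e) {Z : ℝ → ℝ} {φ : ℝ → ℝ → ℝ} (hφ : IsFlowOn J Z φ) :
    Z e = 0 := by
  have hd := hφ.hasDerivAt e hJ.mem 0
  have h0 := hφ.zero e hJ.mem
  rw [h0] at hd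
  have hm := hφ.mem e hJ.mem
  rcases hJ with ⟨rfl, rfl⟩ | ⟨rfl, rfl⟩
  · refine IsLocalMin.hasDerivAt_eq_zero (Eventually.of_forall fun s => ?_) hd
    simp only [h0]
    exact (hm s).1
  · refine IsLocalMax.hasDerivAt_eq_zero (Eventually.of_forall fun s => ?_) hd
    simp only [h0]
    exact (hm s).2

end IsHalfOpen

section Generator

variable {K : NNReal} {f : HomeoPlus} {J : Set ℝ} {e : ℝ} {Z : ℝ → ℝ} {φ : ℝ → ℝ → ℝ}

theorem noInteriorFixedPoint_extend (hno : NoInteriorFixedPoint f) {x : ℝ}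
    (hx : x ∈ Ioo (0 : ℝ) 1) : extend f x ≠ x := by
  rw [extend_of_mem f (Ioo_subset_Icc_self hx)]
  exact hno x hx

theorem GeneratesOn.one_apply (hJ : IsHalfOpen J e) (hZ : GeneratesOn J f Z φ) {x : ℝ}
    (hx : x ∈ J) : φ 1 x = extend f x := by
  rw [hZ.2.2 x hx, extend_of_mem f (hJ.subset hx)]

theorem GeneratesOn.ne_zero (hJ : IsHalfOpen J e) (hZ : GeneratesOn J f Z φ)
    (hno : NoInteriorFixedPoint f) {x : ℝ} (hx : x ∈ Ioo (0 : ℝ) 1) (t : ℝ) : Z (φ t x) ≠ 0 := by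
  intro hc
  have hxJ := hJ.Ioo_subset hx
  have h1 := hZ.2.1.eq_of_zero hJ.ordConnected hZ.1 hxJ hc
  refine noInteriorFixedPoint_extend hno hx ?_
  rw [← hZ.one_apply hJ hxJ, h1 1, ← h1 0, hZ.2.1.zero x hxJ]

theorem GeneratesOn.ne_zero' (hJ : IsHalfOpen J e) (hZ : GeneratesOn J f Z φ)
    (hno : NoInteriorFixedPoint f) {x : ℝ} (hx : x ∈ Ioo (0 : ℝ) 1) : Z x ≠ 0 := by
  have := hZ.ne_zero hJ hno hx 0
  rwa [hZ.2.1.zero x (hJ.Ioo_subset hx)] at this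

theorem GeneratesOn.mem_Ioo (hJ : IsHalfOpen J e) (hZ : GeneratesOn J f Z φ)
    (hno : NoInteriorFixedPoint f) {x : ℝ} (hx : x ∈ Ioo (0 : ℝ) 1) (t : ℝ) :
    φ t x ∈ Ioo (0 : ℝ) 1 := by
  refine hJ.mem_Ioo (hZ.2.1.mem x (hJ.Ioo_subset hx) t) fun hc => ?_
  refine hZ.ne_zero hJ hno hx t ?_
  rw [hc, hJ.apply_eq_zero hZ.2.1]

/-- The time-1 map commutes with the flow; differentiate at time 0. As `X` obeys the same equation,
`Z / X` is constant along orbits in `(0,1)` when `f` has no interior fixed point. -/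
theorem GeneratesOn.apply_extend (hJ : IsHalfOpen J e) (hZ : GeneratesOn J f Z φ)
    (h : IsParabolic K (extend f)) {x : ℝ} (hx : x ∈ J) :
    Z (extend f x) = Real.exp (logD (extend f) x) * Z x := by
  have hFx : extend f x ∈ J := by
    rw [← hZ.one_apply hJ hx]
    exact hZ.2.1.mem x hx 1
  have h1 := hZ.2.1.hasDerivAt _ hFx 0
  rw [hZ.2.1.zero _ hFx] at h1
  have h2 : HasDerivAt (fun t => extend f (φ t x)) (Real.exp (logD (extend f) x) * Z x) 0 := by
    have a := h.hasDerivAt (φ 0 x)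
    have b := hZ.2.1.hasDerivAt x hx 0
    have c := a.comp 0 b
    rw [hZ.2.1.zero x hx] at c
    exact c
  have e1 : (fun t => extend f (φ t x)) = fun t => φ t (extend f x) := by
    funext t
    rw [← hZ.one_apply hJ (hZ.2.1.mem x hx t), ← hZ.one_apply hJ hx,
      ← hZ.2.1.add hJ.ordConnected hZ.1 hx, ← hZ.2.1.add hJ.ordConnected hZ.1 hx, add_comm]
  rw [e1] at h2
  exact h1.unique h2

theorem GeneratesOn.exists_eq_disp (hJ : IsHalfOpen J e) (hZ : GeneratesOn J f Z φ)
    (hno : NoInteriorFixedPoint f) (h : IsParabolic K (extend f)) {x : ℝ}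
    (hx : x ∈ Ioo (0 : ℝ) 1) :
    ∃ c ∈ uIcc x (extend f x), Z c = disp (extend f) x := by
  have hFx : extend f x ∈ Ioo (0 : ℝ) 1 :=
    h.mem_Ioo_pow (noInteriorFixedPoint_extend hno hx) 1
  have hsub : uIcc x (extend f x) ⊆ Ioo 0 1 := ordConnected_Ioo.uIcc_subset hx hFx
  have hc : ContinuousOn Z (Ioo 0 1) := hZ.1.continuousOn.mono hJ.Ioo_subset
  have hI := integral_inv_along_curve hc (fun y hy => hZ.ne_zero' hJ hno hy)
    (hZ.2.1.hasDerivAt x (hJ.Ioo_subset hx)) (hZ.mem_Ioo hJ hno hx) 1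
  rw [hZ.2.1.zero x (hJ.Ioo_subset hx), hZ.one_apply hJ (hJ.Ioo_subset hx)] at hI
  obtain ⟨c, hcm, e1⟩ := exists_intervalIntegral_eq_mul
    ((hc.inv₀ fun y hy => hZ.ne_zero' hJ hno hy).mono hsub)
  refine ⟨c, hcm, ?_⟩
  simp only [Pi.inv_apply] at e1
  rw [hI] at e1
  have := hZ.ne_zero' hJ hno (hsub hcm)
  rw [disp]
  field_simp at e1
  exact e1

/-- Kopell's argument: near the fixed point of a half-open interval a generating vector field is
asymptotic to the displacement. -/
theorem GeneratesOn.tendsto_div_disp (hJ : IsHalfOpen J e) (hZ : GeneratesOn J f Z φ)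
    (hno : NoInteriorFixedPoint f) (h : IsParabolic K (extend f)) {x : ℕ → ℝ}
    (hx : ∀ n, x n ∈ Ioo (0 : ℝ) 1) (hlim : Tendsto x atTop (𝓝 e)) {r : ℝ}
    (hr : ∀ n, Z (x n) = r * szekeres (extend f) (x n)) :
    Tendsto (fun n => Z (x n) / disp (extend f) (x n)) atTop (𝓝 1) := by
  have hFe : extend f e = e := h.fixed_of_notMem e hJ.notMem_Ioo
  have hxe : ∀ n, x n ≠ e := fun n hc => hJ.notMem_Ioo (hc ▸ hx n)
  have hcd : ContinuousOn (derivWithin Z J) J :=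
    hZ.1.continuousOn_derivWithin hJ.uniqueDiffOn le_rfl
  have hd : ∀ y ∈ J, HasDerivWithinAt Z (derivWithin Z J y) J y := fun y hy =>
    (hZ.1.differentiableOn one_ne_zero y hy).hasDerivWithinAt
  have hd' : ∀ y ∈ Ioo (0 : ℝ) 1, HasDerivAt Z (derivWithin Z J y) y := fun y hy =>
    (hd y (hJ.Ioo_subset hy)).hasDerivAt
      (mem_of_superset (isOpen_Ioo.mem_nhds hy) hJ.Ioo_subset)
  have hlimJ : Tendsto x atTop (𝓝[J \ {e}] e) :=
    tendsto_nhdsWithin_iff.2 ⟨hlim, Eventually.of_forall fun n => ⟨hJ.Ioo_subset (hx n), hxe n⟩⟩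
  -- Along the sequence `Z = r X`, so the slopes of `Z` at `e` are `r` times those of `X`, which
  -- tend to 0.
  have hder0 : derivWithin Z J e = 0 := by
    have h1 := (hasDerivWithinAt_iff_tendsto_slope.1 (hd e hJ.mem)).comp hlimJ
    have h2 := (hasDerivWithinAt_iff_tendsto_slope.1
      (h.hasDerivAt_szekeres e).hasDerivWithinAt).comp hlimJ
    rw [IsParabolic.szekeresDeriv_fixed hFe] at h2
    have h3 := h2.const_mul r
    rw [mul_zero] at h3
    refine tendsto_nhds_unique h1 (h3.congr fun n => ?_)
    simp only [Function.comp, slope_def_field, hJ.apply_eq_zero hZ.2.1,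
      IsParabolic.szekeres_eq_zero_iff.2 hFe, hr, sub_zero]
    ring
  choose ξ hξ eξ using fun n => hZ.exists_eq_disp hJ hno h (hx n)
  have hsub : ∀ n, uIcc (x n) (extend f (x n)) ⊆ Ioo 0 1 := fun n =>
    ordConnected_Ioo.uIcc_subset (hx n) (h.mem_Ioo_pow (noInteriorFixedPoint_extend hno (hx n)) 1)
  have hsub' : ∀ n, uIcc (ξ n) (x n) ⊆ uIcc (x n) (extend f (x n)) := fun n =>
    uIcc_subset_uIcc (hξ n) left_mem_uIcc
  -- `Z (x n)` differs from the displacement `Z (ξ n)` by `Z'(η n) (x n - ξ n)`, where `|x n - ξ n|`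
  -- is at most the displacement and `Z'(η n)` tends to `Z'(e) = 0`.
  choose η hη eη using fun n => exists_sub_eq_mul_of_hasDerivAt (a := ξ n) (b := x n) fun y hy =>
    hd' y (hsub n (hsub' n hy))
  have hFlim : Tendsto (fun n => extend f (x n)) atTop (𝓝 e) := by
    have := ((extend f).continuous.tendsto e).comp hlim
    rwa [hFe] at this
  have hηlim : Tendsto η atTop (𝓝 e) := by
    refine tendsto_of_tendsto_of_tendsto_of_le_of_le (g := fun n => min (x n) (extend f (x n)))
      (h := fun n => max (x n) (extend f (x n))) ?_ ?_ (fun n => (hsub' n (hη n)).1)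
      (fun n => (hsub' n (hη n)).2)
    · simpa using hlim.min hFlim
    · simpa using hlim.max hFlim
  have hηd : Tendsto (fun n => |derivWithin Z J (η n)|) atTop (𝓝 0) := by
    have h1 : Tendsto η atTop (𝓝[J] e) := tendsto_nhdsWithin_iff.2
      ⟨hηlim, Eventually.of_forall fun n => hJ.Ioo_subset (hsub n (hsub' n (hη n)))⟩
    have h2 := ((hcd e hJ.mem).tendsto.comp h1).abs
    rwa [hder0, abs_zero] at h2
  refine tendsto_iff_norm_sub_tendsto_zero.2
    (squeeze_zero (fun _ => norm_nonneg _) (fun n => ?_) hηd)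
  have hne : disp (extend f) (x n) ≠ 0 :=
    mt disp_eq_zero_iff.1 (noInteriorFixedPoint_extend hno (hx n))
  rw [Real.norm_eq_abs, div_sub_one hne, ← eξ, eη, abs_div, abs_mul, mul_div_assoc, eξ]
  refine mul_le_of_le_one_right (abs_nonneg _) ?_
  rw [div_le_one (abs_pos.2 hne)]
  exact abs_sub_le_abs_sub_of_mem_uIcc left_mem_uIcc (hξ n)

theorem tendsto_orbit_one {F : ℝ ≃o ℝ} (h : IsParabolic K F)
    (hno : ∀ x ∈ Ioo (0 : ℝ) 1, F x ≠ x) {x : ℝ} (hx : x < F x) :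
    Tendsto (fun n : ℕ => (F ^ n) x) atTop (𝓝 1) := by
  obtain ⟨p, hp, hlim⟩ := h.exists_tendsto_orbit x
  have hm : Monotone (fun n : ℕ => (F ^ n) x) := monotone_nat_of_le_succ fun n => by
    rw [pow_succ_apply]
    exact (F ^ n).monotone hx.le
  have h1 : x ≤ p := hm.ge_of_tendsto hlim 0
  have h2 : p ≤ 1 := le_of_tendsto' hlim fun n => (h.mem_Ioo_pow hx.ne' n).2.le
  have h3 : p = 1 := by
    by_contra hc
    exact hno p ⟨(h.mem_Ioo_of_ne hx.ne').1.trans_le h1, h2.lt_of_ne hc⟩ hp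
  rwa [← h3]

theorem tendsto_orbit_zero {F : ℝ ≃o ℝ} (h : IsParabolic K F)
    (hno : ∀ x ∈ Ioo (0 : ℝ) 1, F x ≠ x) {x : ℝ} (hx : F x < x) :
    Tendsto (fun n : ℕ => (F ^ n) x) atTop (𝓝 0) := by
  obtain ⟨p, hp, hlim⟩ := h.exists_tendsto_orbit x
  have hm : Antitone (fun n : ℕ => (F ^ n) x) := antitone_nat_of_succ_le fun n => by
    rw [pow_succ_apply]
    exact (F ^ n).monotone hx.le
  have h1 : p ≤ x := hm.le_of_tendsto hlim 0
  have h2 : 0 ≤ p := ge_of_tendsto' hlim fun n => (h.mem_Ioo_pow hx.ne n).1.le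
  have h3 : p = 0 := by
    by_contra hc
    exact hno p ⟨h2.lt_of_ne (Ne.symm hc), h1.trans_lt (h.mem_Ioo_of_ne hx.ne).2⟩ hp
  rwa [← h3]

/-- The Szekeres field of a parabolic diffeomorphism with sublinear variation generates it on every
interval between `(0,1)` and `[0,1]`. -/
theorem exists_generatesOn_szekeres (h : IsParabolic K (extend f))
    (hV : HasSublinearVariation (extend f)) :
    ∃ φ : ℝ → ℝ → ℝ, (∀ x, φ 0 x = x) ∧
      (∀ x t, HasDerivAt (fun s => φ s x) (szekeres (extend f) (φ t x)) t) ∧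
      ∀ J : Set ℝ, Ioo 0 1 ⊆ J → J ⊆ Icc 0 1 → GeneratesOn J f (szekeres (extend f)) φ := by
  obtain ⟨φ, h0, hφ⟩ := h.exists_flow_szekeres
  refine ⟨φ, h0, hφ, fun J h1 h2 =>
    ⟨(h.contDiff_szekeres hV).contDiffOn, ⟨fun x hx t => ?_, fun x _ => h0 x, fun x _ t => hφ x t⟩,
      fun x hx => ?_⟩⟩
  · by_cases hc : extend f (φ t x) = φ t x
    · rw [← h.curve_eq_of_fixed hV (hφ x) hc 0, h0]
      exact hx
    · exact h1 (h.mem_Ioo_of_ne hc)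
  · rw [h.curve_one hV (hφ x), h0, extend_of_mem f (h2 hx)]

/-- The generating vector field on a half-open interval is unique. -/
theorem GeneratesOn.eq_szekeres (hJ : IsHalfOpen J e) (hZ : GeneratesOn J f Z φ)
    (hno : NoInteriorFixedPoint f) (h : IsParabolic K (extend f))
    (hV : HasSublinearVariation (extend f)) {x : ℝ} (hx : x ∈ Ioo (0 : ℝ) 1) :
    Z x = szekeres (extend f) x := by
  have hnoF : ∀ y ∈ Ioo (0 : ℝ) 1, extend f y ≠ y := fun y hy => noInteriorFixedPoint_extend hno hy
  have hnoG : ∀ y ∈ Ioo (0 : ℝ) 1, (extend f)⁻¹ y ≠ y := fun y hy =>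
    mt (inv_apply_eq_self_iff _ y).1 (hnoF y hy)
  have hX0 : ∀ y ∈ Ioo (0 : ℝ) 1, szekeres (extend f) y ≠ 0 := fun y hy =>
    mt IsParabolic.szekeres_eq_zero_iff.1 (hnoF y hy)
  -- The relation `Z = r X` propagates along the whole orbit of `x`. The forward or the backward
  -- half converges to `e`, where `Z` and `X` are both asymptotic to the displacement; this forces
  -- `r = 1`.
  set r := Z x / szekeres (extend f) x
  have hstep : ∀ y ∈ Ioo (0 : ℝ) 1,
      (Z (extend f y) = r * szekeres (extend f) (extend f y) ↔
        Z y = r * szekeres (extend f) y) := fun y hy => by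
    rw [hZ.apply_extend hJ h (hJ.Ioo_subset hy), h.szekeres_apply, mul_left_comm]
    exact mul_right_inj' (Real.exp_ne_zero _)
  have hr0 : Z x = r * szekeres (extend f) x := (div_mul_cancel₀ _ (hX0 x hx)).symm
  have key : ∃ u : ℕ → ℝ, (∀ n, u n ∈ Ioo (0 : ℝ) 1) ∧ Tendsto u atTop (𝓝 e) ∧
      ∀ n, Z (u n) = r * szekeres (extend f) (u n) := by
    have hF : ∀ n : ℕ, Z ((extend f ^ n) x) = r * szekeres (extend f) ((extend f ^ n) x) := by
      intro n
      induction n with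
      | zero => exact hr0
      | succ n ih =>
        rw [pow_succ_apply']
        exact (hstep _ (h.mem_Ioo_pow (hnoF x hx) n)).2 ih
    have hG : ∀ n : ℕ, Z (((extend f)⁻¹ ^ n) x) =
        r * szekeres (extend f) (((extend f)⁻¹ ^ n) x) := by
      intro n
      induction n with
      | zero => exact hr0
      | succ n ih =>
        refine (hstep _ (h.inv.mem_Ioo_pow (hnoG x hx) (n + 1))).1 ?_
        rw [pow_succ_apply', apply_inv_apply]
        exact ih
    have mF := h.mem_Ioo_pow (hnoF x hx)
    have mG := h.inv.mem_Ioo_pow (hnoG x hx)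
    rcases lt_or_gt_of_ne (hnoF x hx) with hlt | hlt
    · have hlt' : x < (extend f)⁻¹ x := by
        simpa [inv_apply_apply] using ((extend f)⁻¹ : ℝ ≃o ℝ).strictMono hlt
      rcases hJ with ⟨-, rfl⟩ | ⟨-, rfl⟩
      · exact ⟨_, mF, tendsto_orbit_zero h hnoF hlt, hF⟩
      · exact ⟨_, mG, tendsto_orbit_one h.inv hnoG hlt', hG⟩
    · have hlt' : (extend f)⁻¹ x < x := by
        simpa [inv_apply_apply] using ((extend f)⁻¹ : ℝ ≃o ℝ).strictMono hlt
      rcases hJ with ⟨-, rfl⟩ | ⟨-, rfl⟩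
      · exact ⟨_, mG, tendsto_orbit_zero h.inv hnoG hlt', hG⟩
      · exact ⟨_, mF, tendsto_orbit_one h hnoF hlt, hF⟩
  obtain ⟨u, hu, hulim, hur⟩ := key
  obtain ⟨φ₀, -, -, hgen⟩ := exists_generatesOn_szekeres h hV
  have t1 := hZ.tendsto_div_disp hJ hno h hu hulim hur
  have t2 := ((hgen J hJ.Ioo_subset hJ.subset).tendsto_div_disp hJ hno h hu hulim (r := 1)
    fun n => (one_mul _).symm).const_mul r
  have hr1 : r = 1 := by
    have := tendsto_nhds_unique t1 (t2.congr fun n => by rw [hur, mul_div_assoc])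
    rw [mul_one] at this
    exact this.symm
  rw [hr0, hr1, one_mul]

/-- Both half-open generators coincide with `X` on `(0,1)`, so a single flow defines `M` and the
group law makes `M` a translation. -/
theorem hasTrivialMatherInvariant_of_isParabolic (hno : NoInteriorFixedPoint f)
    (h : IsParabolic K (extend f)) (hV : HasSublinearVariation (extend f)) :
    HasTrivialMatherInvariant f := by
  obtain ⟨φ₀, h0, hφ₀, hgen⟩ := exists_generatesOn_szekeres h hV
  have hJ₀ : IsHalfOpen (Ico 0 1) 0 := Or.inl ⟨rfl, rfl⟩
  have hJ₁ : IsHalfOpen (Ioc 0 1) 1 := Or.inr ⟨rfl, rfl⟩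
  have g₀ := hgen _ hJ₀.Ioo_subset hJ₀.subset
  have g₁ := hgen _ hJ₁.Ioo_subset hJ₁.subset
  have hcurve : ∀ {J : Set ℝ} {e : ℝ} {Z : ℝ → ℝ} {φ : ℝ → ℝ → ℝ}, IsHalfOpen J e →
      GeneratesOn J f Z φ → ∀ a ∈ Ioo (0 : ℝ) 1, ∀ t, φ t a = φ₀ t a := by
    intro J e Z φ hJ hZ a ha t
    have haJ := hJ.Ioo_subset ha
    have := integralCurve_unique ordConnected_univ (h.contDiff_szekeres hV).contDiffOn
      (γ₁ := fun t => φ t a) (γ₂ := fun t => φ₀ t a)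
      (fun t => by
        rw [← hZ.eq_szekeres hJ hno h hV (hZ.mem_Ioo hJ hno ha t)]
        exact hZ.2.1.hasDerivAt a haJ t) (fun _ => mem_univ _) (hφ₀ a) (fun _ => mem_univ _)
      (by rw [hZ.2.1.zero a haJ, h0])
    exact congrFun this t
  refine Subset.antisymm ?_ ?_
  · rintro M ⟨X, φ, Y, ψ, hX, hY, a, ha, b, hb, hM⟩
    have hM' : ∀ t, φ₀ (M t) b = φ₀ t a := fun t => by
      rw [← hcurve hJ₁ hY b hb, ← hcurve hJ₀ hX a ha, hM]
    -- Time is recovered from position as the integral of `1 / X`.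
    have hinj : Function.Injective fun t => φ₀ t b := by
      intro s t hst
      have hne : ∀ y ∈ Ioo (0 : ℝ) 1, szekeres (extend f) y ≠ 0 := fun y hy =>
        g₀.ne_zero' hJ₀ hno hy
      have hI := integral_inv_along_curve (h.contDiff_szekeres hV).continuous.continuousOn hne
        (hφ₀ b) (g₀.mem_Ioo hJ₀ hno hb)
      rw [← hI s, ← hI t]
      simp only at hst
      rw [hst]
    refine ⟨M 0, fun t => hinj ?_⟩
    have hbJ := hJ₀.Ioo_subset hb
    simp only [hM', g₀.2.1.add hJ₀.ordConnected g₀.1 hbJ, h0]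
  · rintro M ⟨c, hc⟩
    have ha : (1 / 2 : ℝ) ∈ Ioo (0 : ℝ) 1 := by norm_num
    -- Equality of classes also needs every translation to occur: shifting the base point `b` back
    -- by time `c` realises `t + c`.
    refine ⟨_, φ₀, _, φ₀, g₀, g₁, 1 / 2, ha, φ₀ (-c) (1 / 2), g₀.mem_Ioo hJ₀ hno ha (-c),
      fun t => ?_⟩
    rw [hc, ← g₀.2.1.add hJ₀.ordConnected g₀.1 (hJ₀.Ioo_subset ha), add_neg_cancel_right]

end Generator

theorem corollaryI :
    (∀ f : DiffPlus 2, NoInteriorFixedPoint (f : HomeoPlus) →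
      ¬ HasTrivialMatherInvariant (f : HomeoPlus) →
      ¬ IsDistortedElement (Subgroup.inclusion diffPlus_two_le f)) ∧
    (∀ f : DiffPlus 2, ¬ IsTimeOneMap (f : HomeoPlus) →
      ¬ IsDistortedElement (Subgroup.inclusion diffPlus_two_le f)) := by
  constructor
  · intro f hno hM hdist
    obtain ⟨⟨K, h⟩, hV⟩ := exists_isParabolic_of_isDistortedElement hdist
    exact hM (hasTrivialMatherInvariant_of_isParabolic hno h hV)
  · intro f hf hdist
    obtain ⟨⟨K, h⟩, hV⟩ := exists_isParabolic_of_isDistortedElement hdist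
    obtain ⟨φ, -, -, hgen⟩ := exists_generatesOn_szekeres h hV
    exact hf ⟨_, φ, hgen _ Ioo_subset_Icc_self Subset.rfl⟩
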